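/- Let $\omega>0$, $\alpha,a,b,d_2\in\mathbb R$, $\beta=-\tfrac{16}{3}\alpha\omega<1$, and let $R_0>0$ be given by $$R_0^2(z)=\frac{4\omega}{1+\sqrt{1-\beta}\,\cosh(2\sqrt\omega\,z)},\qquad S_0=R_0'/R_0 .$$ Put $\Lambda_m=\int_{-\infty}^{\infty}R_0^m(s)\,ds$, $\Lambda_2'=\int_{-\infty}^{\infty}(R_0')^2(s)\,ds$, $\Lambda_{24}=\Lambda_2/\Lambda_4$, and $$\Lambda_{d_2}=-\frac{8\omega}{\beta}\Big(\omega\Lambda_{24}-\frac34\Big)\ \text{ if }\beta\ne0,\qquad \Lambda_{d_2}=\Lambda_6/\Lambda_4\ \text{ (the limiting value) if }\beta=0,$$ $$d_1^*=\tfrac14a-\Lambda_{24}\,b-\Lambda_{d_2}\big(d_2-\tfrac13\alpha a\big).$$ For $\varepsilon>0$, $d_1\in\mathbb R$ and $\Delta=1+\varepsilon^2a^2$ consider the steady-state system at zero wave speed, $$\begin{aligned} r'&=rs,\qquad \theta'=\varphi,\\ \Delta s'&=-\Delta s^2+\Delta\varphi^2-(-\omega+\varepsilon^2ab)-(1+\varepsilon^2ad_1)r^2-(\alpha+\varepsilon^2ad_2)r^4,\\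 \Delta\varphi'&=-2\Delta s\varphi-\varepsilon\big[(b+a\omega)+(d_1-a)r^2+(d_2-a\alpha)r^4\big].\end{aligned}$$ A bright solitary wave is a solution on $\mathbb R$ with $r>0$ and $r(z)\to0$ as $z\to\pm\infty$. It is called $\delta$-close to the unperturbed wave if $|r-R_0|\le\delta$, $|s-S_0|\le\delta$ and $|\varphi|\le\delta$ for all $z\in\mathbb R$. Then the following hold. 1. (Necessary condition.) Suppose that $\varepsilon_n>0$, $\varepsilon_n\to0$, $\delta_n\to0$, $d_{1,n}\to d_1$, and that for each $n$ the system with parameters $\varepsilon_n,d_{1,n}$ (and $\alpha,\omega,a,b,d_2$) has a bright solitary wave $\delta_n$-close to the unperturbed one. Then $$\Lambda_2'a-\Lambda_2b-\Lambda_4d_1-\Lambda_6d_2=0 .$$ 2. For every $d_1\in\mathbb R$, this equality holds if and only if $d_1=d_1^*$. 3. There are $\delta>0$, $\varepsilon_0>0$ and $C$, depending only on $\alpha,\omega,a,b,d_2$, such that whenever $0<\varepsilon<\varepsilon_0$, $d_1\in\mathbb R$, and the system has a bright solitary wave $\delta$-close to the unperturbed one, then $|d_1-d_1^*|\le C\varepsilon$.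 -/

import Mathlib

namespace PCQNLS

open Filter Topology MeasureTheory

/-- `β = -16αω/3`. -/
noncomputable def beta (α ω : ℝ) : ℝ := -(16 / 3) * α * ω

/-- The amplitude of the unperturbed wave,
`R₀²(z) = 4ω / (1 + √(1-β) cosh(2√ω z))`, `R₀ > 0` (for `ω > 0`, `β < 1`). -/
noncomputable def R0 (α ω z : ℝ) : ℝ :=
  Real.sqrt (4 * ω /
    (1 + Real.sqrt (1 - beta α ω) * Real.cosh (2 * Real.sqrt ω * z)))

/-- `S₀ = R₀' / R₀`. -/
noncomputable def S0 (α ω z : ℝ) : ℝ := deriv (R0 α ω) z / R0 α ω z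

/-- `Λ_m = ∫ R₀^m`. -/
noncomputable def Lam (m : ℕ) (α ω : ℝ) : ℝ := ∫ s : ℝ, (R0 α ω s) ^ m

/-- `Λ₂' = ∫ (R₀')²`. -/
noncomputable def Lam2' (α ω : ℝ) : ℝ := ∫ s : ℝ, (deriv (R0 α ω) s) ^ 2

/-- `Λ₂₄ = Λ₂ / Λ₄`. -/
noncomputable def Lam24 (α ω : ℝ) : ℝ := Lam 2 α ω / Lam 4 α ω

open Classical in
/-- `Λ_{d₂} = -(8ω/β) (ω Λ₂₄ - 3/4)`. For `β = 0` (that is `α = 0`) this expression is `0/0`,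
and its limiting value `Λ₆ / Λ₄` is taken. -/
noncomputable def LamD2 (α ω : ℝ) : ℝ :=
  if beta α ω = 0 then Lam 6 α ω / Lam 4 α ω
  else -(8 * ω / beta α ω) * (ω * Lam24 α ω - 3 / 4)

/-- The leading-order value `d₁* = a/4 - Λ₂₄ b - Λ_{d₂} (d₂ - α a / 3)`. -/
noncomputable def d1Star (α ω a b d₂ : ℝ) : ℝ :=
  1 / 4 * a - Lam24 α ω * b - LamD2 α ω * (d₂ - 1 / 3 * α * a)

/-- The coefficients of the perturbed cubic-quintic equation, and the frequency `ω`. -/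
structure Params where
  α : ℝ
  ω : ℝ
  a : ℝ
  b : ℝ
  d₁ : ℝ
  d₂ : ℝ

/-- `(r, θ, s, φ)` solves, on the whole line, the steady-state ODE with perturbation
parameter `ε` and wave speed `c`; here `Δ = 1 + ε²a²`. -/
structure IsSteadyState (p : Params) (ε c : ℝ) (r θ s φ : ℝ → ℝ) : Prop where
  eq_r : ∀ z, HasDerivAt r (r z * s z) z
  eq_theta : ∀ z, HasDerivAt θ (φ z) z
  differentiable_s : Differentiable ℝ s
  eq_s : ∀ z, (1 + ε ^ 2 * p.a ^ 2) * deriv s z =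
    -(1 + ε ^ 2 * p.a ^ 2) * s z ^ 2 + (1 + ε ^ 2 * p.a ^ 2) * φ z ^ 2
      - c * (ε * p.a * s z - φ z) - (-p.ω + ε ^ 2 * p.a * p.b)
      - (1 + ε ^ 2 * p.a * p.d₁) * r z ^ 2 - (p.α + ε ^ 2 * p.a * p.d₂) * r z ^ 4
  differentiable_phi : Differentiable ℝ φ
  eq_phi : ∀ z, (1 + ε ^ 2 * p.a ^ 2) * deriv φ z =
    -2 * (1 + ε ^ 2 * p.a ^ 2) * s z * φ z - c * (s z + ε * p.a * φ z)
      - ε * ((p.b + p.a * p.ω) + (p.d₁ - p.a) * r z ^ 2 + (p.d₂ - p.a * p.α) * r z ^ 4)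

/-- A standing (`c = 0`) solution whose amplitude is positive and decays at both ends. -/
structure IsBrightWave (p : Params) (ε : ℝ) (r θ s φ : ℝ → ℝ) : Prop where
  steady : IsSteadyState p ε 0 r θ s φ
  pos : ∀ z, 0 < r z
  tendsto_atBot : Tendsto r atBot (𝓝 0)
  tendsto_atTop : Tendsto r atTop (𝓝 0)

/-- For the parameters `p` and `ε` there is a bright solitary wave which, uniformly in `z`, is
`δ`-close in the `(r, s, φ)` phase space to the unperturbed wave `(R₀, S₀, 0)`. (The phase `θ`
is recovered from `θ' = φ` and does not enter the other equations. As the ODE is autonomous,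
waves are understood up to translation in `z`.) -/
def HasBrightWaveNear (p : Params) (ε δ : ℝ) : Prop :=
  ∃ r θ s φ : ℝ → ℝ, IsBrightWave p ε r θ s φ ∧
    ∀ z, |r z - R0 p.α p.ω z| ≤ δ ∧ |s z - S0 p.α p.ω z| ≤ δ ∧ |φ z| ≤ δ

end PCQNLS

/-!
The equation for `φ`, multiplied by `r²`, reads `(r²φ)' = -(ε/Δ) r² P(r²)` with
`P(u) = (b + aω) + (d₁ - a) u + (d₂ - aα) u²`. A bright wave therefore satisfies
`∫ r² P(r²) = 0` exactly. With `r = R₀` this is the solvability condition, by the two moment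
identities `Λ₂' = ωΛ₂ - Λ₄/2 - αΛ₆/3` and `2ωΛ₂ = 3Λ₄/2 + 4αΛ₆/3` (`Lam2'_eq`,
`moment_relation`). They also give `Λ_{d₂} = Λ₆/Λ₄`, hence the equivalence with `d₁ = d₁*`
(`solvability_iff`).

The quantitative estimate `exists_abs_sub_d1Star_le` implies the necessary condition, since it
forces `d₁,ₙ → d₁*`. In it `r` is only `δ`-close to `R₀` for a fixed `δ`, so `∫ r² P(r²)` cannot
be compared with its value at `R₀` by continuity. The comparison is made in the phase plane.

* The logarithmic derivative of `r / R₀` is at most `δ`, so `r²` decays outward from every point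
  (`exists_outward_decay`). Consequently, if `(r²f)' = r²g` with `f` bounded, then
  `|f| ≤ const · sup |g|` (`ControlledOrbit.abs_le_of_hasDerivAt_sq_mul`).
* The identity `∫ r² P(r²) = 0` bounds `d₁`. Then `φ = O(ε)` by the previous point, and the
  same point applied to the energy `e = s² - ω + r²/2 + αr⁴/3`, for which `(r²e)' = 2sηr²` with
  `η = s' + s² - ω + r² + αr⁴ = O(ε²)`, gives `e = O(ε²)` (`exists_energy_estimate`).
* On `e = η = 0` both `r²` and `½ + ⅔αr² = -s'/r²` are functions of `s`, so the one-form
  `r² P(r²) dz` is `-G'(s) ds` for an explicit `G'`; for the wave this holds up to `O(ε²) dz`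
  (`exists_forcing_estimate`). With `d₁ = d₁*` in `P`, the solvability condition says
  `G(-√ω) = G(√ω)` (`phase_primitive_eq`).
* So `G(s) - (Δ/ε) r²φ` has derivative `(d₁ - d₁*) r⁴ + O(ε²)`. Its increment over
  `[-1/ε, 1/ε]` is `O(ε)`, and `∫ r⁴` is bounded below, which gives `d₁ - d₁* = O(ε)`.
-/

namespace PCQNLS

open Filter Topology MeasureTheory

/-! ### Mean value comparison -/

theorem abs_sub_le_of_abs_deriv_le {f f' g g' : ℝ → ℝ} {x y : ℝ} (hxy : x ≤ y)
    (hf : ∀ t, HasDerivAt f (f' t) t) (hg : ∀ t, HasDerivAt g (g' t) t)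
    (h : ∀ t ∈ Set.Icc x y, |f' t| ≤ g' t) : |f y - f x| ≤ g y - g x := by
  have key : ∀ F F' : ℝ → ℝ, (∀ t, HasDerivAt F (F' t) t) → (∀ t ∈ Set.Icc x y, 0 ≤ F' t) →
      F x ≤ F y := by
    intro F F' hF hF'
    refine monotoneOn_of_deriv_nonneg (convex_Icc x y)
      (fun t _ => (hF t).continuousAt.continuousWithinAt)
      (fun t _ => (hF t).differentiableAt.differentiableWithinAt) (fun t ht => ?_)
      (Set.left_mem_Icc.2 hxy) (Set.right_mem_Icc.2 hxy) hxy
    rw [(hF t).deriv]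
    exact hF' t (interior_subset ht)
  have h1 := key (fun t => g t - f t) (fun t => g' t - f' t) (fun t => (hg t).sub (hf t))
    (fun t ht => by linarith [(abs_le.1 (h t ht)).2])
  have h2 := key (fun t => g t + f t) (fun t => g' t + f' t) (fun t => (hg t).add (hf t))
    (fun t ht => by linarith [(abs_le.1 (h t ht)).1])
  rw [abs_le]
  constructor <;> linarith

/-! ### The unperturbed wave -/

/-- The denominator `1 + √(1-β) cosh(2√ω z)` of `R₀²`. -/
noncomputable def profileDenom (α ω z : ℝ) : ℝ :=
  1 + Real.sqrt (1 - beta α ω) * Real.cosh (2 * Real.sqrt ω * z)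

section Unperturbed

variable {α ω : ℝ}

theorem sqrt_one_sub_beta_pos (hβ : beta α ω < 1) : 0 < Real.sqrt (1 - beta α ω) :=
  Real.sqrt_pos.2 (by linarith)

theorem profileDenom_pos (α ω z : ℝ) : 0 < profileDenom α ω z := by
  have := Real.cosh_pos (2 * Real.sqrt ω * z)
  unfold profileDenom
  positivity

theorem R0_sq (hω : 0 < ω) (z : ℝ) : R0 α ω z ^ 2 = 4 * ω / profileDenom α ω z := by
  have := profileDenom_pos α ω z
  exact Real.sq_sqrt (by unfold profileDenom at this; positivity)

theorem R0_pos (hω : 0 < ω) (z : ℝ) : 0 < R0 α ω z := by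
  have := profileDenom_pos α ω z
  exact Real.sqrt_pos.2 (by unfold profileDenom at this; positivity)

theorem hasDerivAt_profileDenom (α ω z : ℝ) :
    HasDerivAt (profileDenom α ω)
      (2 * Real.sqrt ω * (Real.sqrt (1 - beta α ω) * Real.sinh (2 * Real.sqrt ω * z))) z := by
  have h := (((hasDerivAt_id z).const_mul (2 * Real.sqrt ω)).cosh.const_mul
    (Real.sqrt (1 - beta α ω))).const_add 1
  refine h.congr_deriv ?_
  simp only [id]
  ring

theorem hasDerivAt_R0_aux (hω : 0 < ω) (z : ℝ) :
    HasDerivAt (R0 α ω) (R0 α ω z *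
      (-(Real.sqrt ω * (Real.sqrt (1 - beta α ω) * Real.sinh (2 * Real.sqrt ω * z)))
        / profileDenom α ω z)) z := by
  have hV := profileDenom_pos α ω z
  have hR := R0_pos (α := α) hω z
  have hR2 := R0_sq (α := α) hω z
  have h := ((hasDerivAt_const z (4 * ω)).div (hasDerivAt_profileDenom α ω z) hV.ne').sqrt
    (by simp only [Pi.div_apply]; positivity)
  refine h.congr_deriv ?_
  change _ / (2 * R0 α ω z) = _
  rw [div_eq_iff (by positivity)]
  have : R0 α ω z * (-(Real.sqrt ω * (Real.sqrt (1 - beta α ω) *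
      Real.sinh (2 * Real.sqrt ω * z))) / profileDenom α ω z) * (2 * R0 α ω z)
      = 2 * R0 α ω z ^ 2 * (-(Real.sqrt ω * (Real.sqrt (1 - beta α ω) *
      Real.sinh (2 * Real.sqrt ω * z))) / profileDenom α ω z) := by ring
  rw [this, hR2]
  field_simp
  ring

theorem S0_eq (hω : 0 < ω) (z : ℝ) : S0 α ω z =
    -(Real.sqrt ω * (Real.sqrt (1 - beta α ω) * Real.sinh (2 * Real.sqrt ω * z)))
        / profileDenom α ω z := by
  rw [S0, (hasDerivAt_R0_aux hω z).deriv, mul_div_cancel_left₀ _ (R0_pos hω z).ne']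

theorem hasDerivAt_R0 (hω : 0 < ω) (z : ℝ) :
    HasDerivAt (R0 α ω) (R0 α ω z * S0 α ω z) z := by
  rw [S0_eq hω]
  exact hasDerivAt_R0_aux hω z

theorem continuous_R0 (hω : 0 < ω) : Continuous (R0 α ω) :=
  continuous_iff_continuousAt.2 fun z => (hasDerivAt_R0 hω z).continuousAt

/-- The homoclinic orbit lies on the zero level of the energy. -/
theorem S0_sq (hω : 0 < ω) (hβ : beta α ω < 1) (z : ℝ) :
    S0 α ω z ^ 2 = ω - R0 α ω z ^ 2 / 2 - α / 3 * R0 α ω z ^ 4 := by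
  have hV := profileDenom_pos α ω z
  have h4 : R0 α ω z ^ 4 = (R0 α ω z ^ 2) ^ 2 := by ring
  rw [h4, R0_sq hω, S0_eq hω]
  have hk : Real.sqrt (1 - beta α ω) ^ 2 = 1 + 16 / 3 * α * ω := by
    rw [Real.sq_sqrt (by linarith), beta]; ring
  have hm : Real.sqrt ω ^ 2 = ω := Real.sq_sqrt hω.le
  have hc := Real.cosh_sq (2 * Real.sqrt ω * z)
  have hVd : profileDenom α ω z - 1 =
    Real.sqrt (1 - beta α ω) * Real.cosh (2 * Real.sqrt ω * z) := by unfold profileDenom; ring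
  have hsq : (profileDenom α ω z - 1) ^ 2 = (1 + 16 / 3 * α * ω) *
      (Real.sinh (2 * Real.sqrt ω * z) ^ 2 + 1) := by
    rw [hVd, mul_pow, hk, hc]
  rw [div_pow, neg_sq, mul_pow, mul_pow, hk, hm]
  field_simp
  linear_combination (-6) * hsq

theorem hasDerivAt_S0 (hω : 0 < ω) (hβ : beta α ω < 1) (z : ℝ) :
    HasDerivAt (S0 α ω) (-(R0 α ω z ^ 2) / 2 - 2 * α / 3 * R0 α ω z ^ 4) z := by
  have hV := profileDenom_pos α ω z
  have hsh : HasDerivAt (fun z => Real.sinh (2 * Real.sqrt ω * z))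
      (Real.cosh (2 * Real.sqrt ω * z) * (2 * Real.sqrt ω)) z := by
    have := ((hasDerivAt_id z).const_mul (2 * Real.sqrt ω)).sinh
    simpa using this
  have h := (((hsh.const_mul (Real.sqrt (1 - beta α ω))).const_mul (Real.sqrt ω)).neg).div
    (hasDerivAt_profileDenom α ω z) hV.ne'
  have h4 : R0 α ω z ^ 4 = (R0 α ω z ^ 2) ^ 2 := by ring
  have hs : S0 α ω z ^ 2 = ω - R0 α ω z ^ 2 / 2 - α / 3 * R0 α ω z ^ 4 := S0_sq hω hβ z
  have hm : Real.sqrt ω ^ 2 = ω := Real.sq_sqrt hω.le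
  have hVd : profileDenom α ω z - 1 =
    Real.sqrt (1 - beta α ω) * Real.cosh (2 * Real.sqrt ω * z) := by unfold profileDenom; ring
  have hfun : S0 α ω = (-fun z => Real.sqrt ω * (Real.sqrt (1 - beta α ω) *
      Real.sinh (2 * Real.sqrt ω * z))) / profileDenom α ω := by
    funext y
    rw [S0_eq hω]; rfl
  rw [hfun]
  refine h.congr_deriv ?_
  rw [S0_eq hω] at hs
  rw [h4, R0_sq hω] at hs ⊢
  have e : ∀ k c σ V m : ℝ, V ≠ 0 → V - 1 = k * c →
      (-(m * (k * (c * (2 * m)))) * V - (-(m * (k * σ))) * (2 * m * (k * σ))) / V ^ 2 =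
      -(2 * m ^ 2 * (V - 1) / V) + 2 * (-(m * (k * σ)) / V) ^ 2 := by
    intro k c σ V m hV0 hVd
    rw [hVd]
    field_simp
    ring
  have e := e _ _ (Real.sinh (2 * Real.sqrt ω * z)) _ (Real.sqrt ω) hV.ne' hVd
  refine Eq.trans e ?_
  rw [hs, hm]
  field_simp
  ring

theorem R0_le (hω : 0 < ω) (z : ℝ) : R0 α ω z ≤ 2 * Real.sqrt ω := by
  have hV := profileDenom_pos α ω z
  have h1 : 1 ≤ profileDenom α ω z := by
    have := Real.cosh_pos (2 * Real.sqrt ω * z)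
    have : 0 ≤ Real.sqrt (1 - beta α ω) * Real.cosh (2 * Real.sqrt ω * z) := by positivity
    unfold profileDenom
    linarith
  refine abs_le_of_sq_le_sq' ?_ (by positivity) |>.2
  rw [R0_sq hω, mul_pow, Real.sq_sqrt hω.le, div_le_iff₀ hV]
  nlinarith

/-- The factor `½ + ⅔ α R₀²`, by which `S₀' = -R₀² (½ + ⅔ α R₀²)`, stays away from zero. -/
theorem half_min_le_factor (hω : 0 < ω) (hβ : beta α ω < 1) (z : ℝ) :
    min 1 (Real.sqrt (1 - beta α ω)) / 2 ≤ 1 / 2 + 2 * α / 3 * R0 α ω z ^ 2 := by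
  have hV := profileDenom_pos α ω z
  rw [R0_sq hω]
  rcases le_or_gt 0 α with hα | hα
  · have : 0 ≤ 2 * α / 3 * (4 * ω / profileDenom α ω z) := by positivity
    linarith [min_le_left 1 (Real.sqrt (1 - beta α ω))]
  · have hk := sqrt_one_sub_beta_pos hβ
    have hk2 : Real.sqrt (1 - beta α ω) ^ 2 = 1 + 16 / 3 * α * ω := by
      rw [Real.sq_sqrt (by linarith), beta]; ring
    have hmin := min_le_right 1 (Real.sqrt (1 - beta α ω))
    have hVk : 1 + Real.sqrt (1 - beta α ω) ≤ profileDenom α ω z := by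
      unfold profileDenom
      nlinarith [Real.one_le_cosh (2 * Real.sqrt ω * z)]
    have e : 1 / 2 + 2 * α / 3 * (4 * ω / profileDenom α ω z) =
        (profileDenom α ω z + (Real.sqrt (1 - beta α ω) ^ 2 - 1)) / (2 * profileDenom α ω z) := by
      rw [hk2]; field_simp; ring
    refine (div_le_div_of_nonneg_right hmin zero_le_two).trans ?_
    rw [e, div_le_div_iff₀ two_pos (by positivity)]
    have hk1 : Real.sqrt (1 - beta α ω) ≤ 1 := by
      refine Real.sqrt_le_iff.2 ⟨zero_le_one, ?_⟩
      rw [beta]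
      nlinarith [mul_neg_of_neg_of_pos hα hω]
    nlinarith [mul_nonneg (sub_nonneg.2 hk1) (sub_nonneg.2 hVk)]

theorem abs_S0_le (hω : 0 < ω) (hβ : beta α ω < 1) (z : ℝ) : |S0 α ω z| ≤ Real.sqrt ω := by
  refine Real.abs_le_sqrt ?_
  rw [S0_sq hω hβ]
  have h := half_min_le_factor hω hβ z
  have := lt_min one_pos (sqrt_one_sub_beta_pos hβ)
  nlinarith [sq_nonneg (R0 α ω z), mul_nonneg (sq_nonneg (R0 α ω z))
    (show 0 ≤ 1 / 2 + 2 * α / 3 * R0 α ω z ^ 2 by linarith)]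

theorem S0_nonpos (hω : 0 < ω) {z : ℝ} (hz : 0 ≤ z) : S0 α ω z ≤ 0 := by
  rw [S0_eq hω, neg_div, neg_nonpos]
  have := profileDenom_pos α ω z
  have : 0 ≤ Real.sinh (2 * Real.sqrt ω * z) := Real.sinh_nonneg_iff.2 (by positivity)
  positivity

theorem S0_neg (hω : 0 < ω) (z : ℝ) : S0 α ω (-z) = - S0 α ω z := by
  rw [S0_eq hω, S0_eq hω]
  simp only [profileDenom, mul_neg, Real.sinh_neg, Real.cosh_neg, neg_neg, neg_div]

end Unperturbed

/-- `t` lies on the half-line from `z` to infinity that does not contain the origin. -/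
def Outward (z t : ℝ) : Prop := (0 ≤ z ∧ z ≤ t) ∨ (t ≤ z ∧ z ≤ 0)

theorem Outward.abs_eq {z t : ℝ} (h : Outward z t) : |t| = |z| + |t - z| := by
  rcases h with ⟨h1, h2⟩ | ⟨h1, h2⟩
  · rw [abs_of_nonneg h1, abs_of_nonneg (h1.trans h2), abs_of_nonneg (by linarith)]; ring
  · rw [abs_of_nonpos h2, abs_of_nonpos (h1.trans h2), abs_of_nonpos (by linarith)]; ring

theorem outward_zero (t : ℝ) : Outward 0 t := by
  rcases le_total 0 t with h | h
  · exact Or.inl ⟨le_rfl, h⟩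
  · exact Or.inr ⟨h, le_rfl⟩

theorem R0_outward {α ω : ℝ} (hω : 0 < ω) (hβ : beta α ω < 1) {z t : ℝ} (h : Outward z t) :
    R0 α ω t ^ 2 * Real.exp (2 * Real.sqrt ω * |t - z|) ≤
      2 * (1 + Real.sqrt (1 - beta α ω)) / Real.sqrt (1 - beta α ω) * R0 α ω z ^ 2 := by
  have hk := sqrt_one_sub_beta_pos hβ
  have hVz := profileDenom_pos α ω z
  have hVt := profileDenom_pos α ω t
  rw [R0_sq hω, R0_sq hω]
  have h1 : profileDenom α ω z ≤
      (1 + Real.sqrt (1 - beta α ω)) * Real.exp (2 * Real.sqrt ω * |z|) := by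
    have h0 : 1 ≤ Real.exp (2 * Real.sqrt ω * |z|) := Real.one_le_exp (by positivity)
    have h2 : Real.cosh (2 * Real.sqrt ω * z) ≤ Real.exp (2 * Real.sqrt ω * |z|) := by
      rw [← Real.cosh_abs, abs_mul, abs_of_nonneg (by positivity : 0 ≤ 2 * Real.sqrt ω),
        Real.cosh_eq]
      have : Real.exp (-(2 * Real.sqrt ω * |z|)) ≤ Real.exp (2 * Real.sqrt ω * |z|) :=
        Real.exp_le_exp.2 (by
          have : 0 ≤ 2 * Real.sqrt ω * |z| := by positivity
          linarith)
      linarith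
    unfold profileDenom
    nlinarith
  have h2 : Real.sqrt (1 - beta α ω) / 2 * Real.exp (2 * Real.sqrt ω * |t|) ≤
      profileDenom α ω t := by
    have h3 : Real.exp (2 * Real.sqrt ω * |t|) / 2 ≤ Real.cosh (2 * Real.sqrt ω * t) := by
      rw [← Real.cosh_abs, abs_mul, abs_of_nonneg (by positivity : 0 ≤ 2 * Real.sqrt ω),
        Real.cosh_eq]
      have := Real.exp_pos (-(2 * Real.sqrt ω * |t|))
      linarith
    unfold profileDenom
    nlinarith
  rw [h.abs_eq, mul_add, Real.exp_add] at h2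
  have hez := Real.exp_pos (2 * Real.sqrt ω * |z|)
  have hed := Real.exp_pos (2 * Real.sqrt ω * |t - z|)
  rw [div_mul_eq_mul_div, div_mul_div_comm, div_le_div_iff₀ hVt (by positivity)]
  have h5 : Real.exp (2 * Real.sqrt ω * |t - z|) * (Real.sqrt (1 - beta α ω) *
      profileDenom α ω z) ≤ 2 * (1 + Real.sqrt (1 - beta α ω)) * profileDenom α ω t := by
    calc _ ≤ Real.exp (2 * Real.sqrt ω * |t - z|) * (Real.sqrt (1 - beta α ω) *
          ((1 + Real.sqrt (1 - beta α ω)) * Real.exp (2 * Real.sqrt ω * |z|))) := by gcongr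
      _ = 2 * (1 + Real.sqrt (1 - beta α ω)) * (Real.sqrt (1 - beta α ω) / 2 *
          (Real.exp (2 * Real.sqrt ω * |z|) * Real.exp (2 * Real.sqrt ω * |t - z|))) := by ring
      _ ≤ _ := by gcongr
  calc _ = 4 * ω * (Real.exp (2 * Real.sqrt ω * |t - z|) * (Real.sqrt (1 - beta α ω) *
      profileDenom α ω z)) := by ring
    _ ≤ 4 * ω * (2 * (1 + Real.sqrt (1 - beta α ω)) * profileDenom α ω t) := by gcongr
    _ = _ := by ring

theorem one_add_sq_le_exp {μ x : ℝ} (hμ : 0 < μ) (hx : 0 ≤ x) :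
    1 + x ^ 2 ≤ (1 + 2 / μ ^ 2) * Real.exp (μ * x) := by
  have h := Real.quadratic_le_exp_of_nonneg (mul_nonneg hμ.le hx)
  have h2 : 0 ≤ 2 / μ ^ 2 := by positivity
  have h3 : 2 / μ ^ 2 * ((μ * x) ^ 2 / 2) = x ^ 2 := by field_simp
  have h4 : 0 ≤ μ * x := mul_nonneg hμ.le hx
  nlinarith [mul_le_mul_of_nonneg_left h h2, sq_nonneg (μ * x)]

/-- A positive function whose logarithmic derivative is uniformly close to `S₀` decays
outward from every point, at a rate that depends on `α` and `ω` only. -/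
theorem exists_outward_decay {α ω : ℝ} (hω : 0 < ω) (hβ : beta α ω < 1) :
    ∃ K > 0, ∀ r s : ℝ → ℝ, (∀ z, HasDerivAt r (r z * s z) z) → (∀ z, 0 < r z) →
      (∀ z, |s z - S0 α ω z| ≤ Real.sqrt ω / 2) →
      ∀ z t, Outward z t → r t ^ 2 * (1 + (t - z) ^ 2) ≤ K * r z ^ 2 := by
  have hk := sqrt_one_sub_beta_pos hβ
  have hμ : 0 < Real.sqrt ω := Real.sqrt_pos.2 hω
  refine ⟨(1 + 2 / Real.sqrt ω ^ 2) * (2 * (1 + Real.sqrt (1 - beta α ω)) /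
    Real.sqrt (1 - beta α ω)), by positivity, fun r s hr hpos hs z t hzt => ?_⟩
  have hR := fun y => R0_pos (α := α) hω y
  -- `log (r / R₀)` is Lipschitz with constant `√ω / 2`, while `R₀²` decays at the rate `2√ω`;
  -- this leaves the rate `√ω` for `r²`
  have hlog : ∀ y, HasDerivAt (fun y => Real.log (r y) - Real.log (R0 α ω y))
      (s y - S0 α ω y) y := by
    intro y
    refine (((hr y).log (hpos y).ne').sub ((hasDerivAt_R0 hω y).log (hR y).ne')).congr_deriv ?_
    rw [mul_div_cancel_left₀ _ (hpos y).ne', mul_div_cancel_left₀ _ (hR y).ne']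
  have hmv := Convex.norm_image_sub_le_of_norm_hasDerivWithin_le
    (fun y _ => (hlog y).hasDerivWithinAt) (fun y _ => hs y) convex_univ
    (Set.mem_univ z) (Set.mem_univ t)
  rw [Real.norm_eq_abs, Real.norm_eq_abs] at hmv
  have hmv' := (abs_le.1 hmv).2
  rw [← Real.log_div (hpos t).ne' (hR t).ne', ← Real.log_div (hpos z).ne' (hR z).ne'] at hmv'
  have hexp : r t / R0 α ω t ≤ r z / R0 α ω z * Real.exp (Real.sqrt ω / 2 * |t - z|) := by
    have h1 := div_pos (hpos t) (hR t)
    have h2 := div_pos (hpos z) (hR z)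
    rw [← Real.log_le_log_iff h1 (by positivity), Real.log_mul h2.ne' (Real.exp_pos _).ne',
      Real.log_exp]
    linarith
  have hsq : (r t / R0 α ω t) ^ 2 ≤
      (r z / R0 α ω z) ^ 2 * Real.exp (Real.sqrt ω * |t - z|) := by
    have h1 := div_pos (hpos t) (hR t)
    refine (pow_le_pow_left₀ h1.le hexp 2).trans_eq ?_
    rw [mul_pow, ← Real.exp_nat_mul]
    congr 2
    push_cast
    ring
  have hexp2 : Real.exp (2 * Real.sqrt ω * |t - z|) =
      Real.exp (Real.sqrt ω * |t - z|) * Real.exp (Real.sqrt ω * |t - z|) := by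
    rw [← Real.exp_add]; congr 1; ring
  have h0 := R0_outward hω hβ hzt
  rw [hexp2] at h0
  have h1 := one_add_sq_le_exp hμ (abs_nonneg (t - z))
  rw [sq_abs] at h1
  set E := Real.exp (Real.sqrt ω * |t - z|)
  set K0 := 2 * (1 + Real.sqrt (1 - beta α ω)) / Real.sqrt (1 - beta α ω)
  set K1 := 1 + 2 / Real.sqrt ω ^ 2
  have hE : 0 < E := Real.exp_pos _
  have hRt := hR t
  have hRz := hR z
  calc r t ^ 2 * (1 + (t - z) ^ 2) ≤ r t ^ 2 * (K1 * E) := by gcongr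
    _ = K1 * ((r t / R0 α ω t) ^ 2 * (R0 α ω t ^ 2 * E)) := by field_simp
    _ ≤ K1 * (((r z / R0 α ω z) ^ 2 * E) * (R0 α ω t ^ 2 * E)) := by gcongr
    _ = K1 * ((r z / R0 α ω z) ^ 2 * (R0 α ω t ^ 2 * (E * E))) := by ring
    _ ≤ K1 * ((r z / R0 α ω z) ^ 2 * (K0 * R0 α ω z ^ 2)) := by gcongr
    _ = K1 * K0 * r z ^ 2 := by field_simp

/-! ### Moments of the unperturbed wave -/

theorem tendsto_zero_of_sq_mul_le {f : ℝ → ℝ} {C : ℝ} (h : ∀ t, f t ^ 2 * (1 + t ^ 2) ≤ C) :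
    Tendsto f (cocompact ℝ) (𝓝 0) := by
  have h1 : Tendsto (fun t : ℝ => C * (1 + ‖t‖ ^ 2)⁻¹) (cocompact ℝ) (𝓝 0) := by
    rw [← mul_zero C]
    refine Tendsto.const_mul _ (tendsto_inv_atTop_zero.comp ?_)
    exact tendsto_atTop_add_const_left _ _
      ((tendsto_pow_atTop two_ne_zero).comp (tendsto_norm_cocompact_atTop (E := ℝ)))
  have h2 : Tendsto (fun t => f t ^ 2) (cocompact ℝ) (𝓝 0) := by
    refine squeeze_zero (fun t => sq_nonneg _) (fun t => ?_) h1
    rw [← div_eq_mul_inv, le_div_iff₀ (by positivity), Real.norm_eq_abs, sq_abs]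
    exact h t
  have h3 := h2.sqrt
  simp only [Real.sqrt_sq_eq_abs, Real.sqrt_zero] at h3
  exact (tendsto_zero_iff_abs_tendsto_zero _).2 h3

section Moments

variable {α ω : ℝ}

/-- The outward decay from the origin, for `R₀` itself. -/
theorem exists_R0_decay (hω : 0 < ω) (hβ : beta α ω < 1) :
    ∃ C, ∀ t, R0 α ω t ^ 2 * (1 + t ^ 2) ≤ C := by
  obtain ⟨K, -, hK⟩ := exists_outward_decay hω hβ
  refine ⟨K * R0 α ω 0 ^ 2, fun t => ?_⟩
  have := hK (R0 α ω) (S0 α ω) (hasDerivAt_R0 hω) (R0_pos hω)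
    (fun z => by rw [sub_self, abs_zero]; positivity) 0 t (outward_zero t)
  simpa using this

theorem tendsto_R0 (hω : 0 < ω) (hβ : beta α ω < 1) :
    Tendsto (R0 α ω) (cocompact ℝ) (𝓝 0) := by
  obtain ⟨C, hC⟩ := exists_R0_decay hω hβ
  exact tendsto_zero_of_sq_mul_le hC

theorem tendsto_S0_sq (hω : 0 < ω) (hβ : beta α ω < 1) :
    Tendsto (fun z => S0 α ω z ^ 2) (cocompact ℝ) (𝓝 ω) := by
  have h := tendsto_R0 hω hβ
  have : Tendsto (fun z => ω - R0 α ω z ^ 2 / 2 - α / 3 * R0 α ω z ^ 4) (cocompact ℝ)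
      (𝓝 (ω - 0 ^ 2 / 2 - α / 3 * 0 ^ 4)) :=
    ((h.pow 2).div_const 2).const_sub ω |>.sub ((h.pow 4).const_mul _)
  simp only [S0_sq hω hβ]
  simpa using this

theorem tendsto_S0_atTop (hω : 0 < ω) (hβ : beta α ω < 1) :
    Tendsto (S0 α ω) atTop (𝓝 (-Real.sqrt ω)) := by
  have h := ((tendsto_S0_sq hω hβ).mono_left atTop_le_cocompact).sqrt.neg
  refine h.congr' ?_
  filter_upwards [eventually_ge_atTop 0] with z hz
  rw [Real.sqrt_sq_eq_abs, abs_of_nonpos (S0_nonpos hω hz), neg_neg]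

theorem tendsto_S0_atBot (hω : 0 < ω) (hβ : beta α ω < 1) :
    Tendsto (S0 α ω) atBot (𝓝 (Real.sqrt ω)) := by
  have h := ((tendsto_S0_atTop hω hβ).comp tendsto_neg_atBot_atTop).neg
  rw [neg_neg] at h
  refine h.congr fun z => ?_
  simp only [Function.comp, S0_neg hω, neg_neg]

theorem integrable_R0_pow (hω : 0 < ω) (hβ : beta α ω < 1) (m : ℕ) :
    Integrable (fun z => R0 α ω z ^ (m + 2)) := by
  obtain ⟨C, hC⟩ := exists_R0_decay hω hβ
  refine Integrable.mono' ((integrable_inv_one_add_sq.const_mul C).const_mul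
    ((2 * Real.sqrt ω) ^ m)) ((continuous_R0 hω).pow _).aestronglyMeasurable
    (Eventually.of_forall fun z => ?_)
  have hR := (R0_pos (α := α) hω z).le
  rw [Real.norm_eq_abs, abs_of_nonneg (by positivity), pow_add]
  have h2 : R0 α ω z ^ 2 ≤ C * (1 + z ^ 2)⁻¹ := by
    rw [← div_eq_mul_inv, le_div_iff₀ (by positivity)]
    exact hC z
  have := R0_le (α := α) hω z
  gcongr

theorem Lam_four_pos (hω : 0 < ω) (hβ : beta α ω < 1) : 0 < Lam 4 α ω := by
  rw [Lam, integral_pos_iff_support_of_nonneg (fun z => (pow_pos (R0_pos hω z) 4).le)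
    (integrable_R0_pow hω hβ 2)]
  have : Function.support (fun z => R0 α ω z ^ 4) = Set.univ :=
    Set.eq_univ_of_forall fun z => (pow_pos (R0_pos hω z) 4).ne'
  rw [this]
  simp

theorem integral_quadratic_R0 (hω : 0 < ω) (hβ : beta α ω < 1) (A B C : ℝ) :
    ∫ z, R0 α ω z ^ 2 * (A + B * R0 α ω z ^ 2 + C * (R0 α ω z ^ 2) ^ 2) =
      A * Lam 2 α ω + B * Lam 4 α ω + C * Lam 6 α ω := by
  have h2 := (integrable_R0_pow hω hβ 0).const_mul A
  have h4 := (integrable_R0_pow hω hβ 2).const_mul B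
  have h6 := (integrable_R0_pow hω hβ 4).const_mul C
  have e : (fun z => R0 α ω z ^ 2 * (A + B * R0 α ω z ^ 2 + C * (R0 α ω z ^ 2) ^ 2)) =
      fun z => A * R0 α ω z ^ (0 + 2) + B * R0 α ω z ^ (2 + 2) + C * R0 α ω z ^ (4 + 2) := by
    funext z; ring
  have h24 : Integrable fun z => A * R0 α ω z ^ (0 + 2) + B * R0 α ω z ^ (2 + 2) := h2.add h4
  rw [e, integral_add h24 h6, integral_add h2 h4, integral_const_mul,
    integral_const_mul, integral_const_mul]
  rfl

theorem integrable_quadratic_R0 (hω : 0 < ω) (hβ : beta α ω < 1) (A B C : ℝ) :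
    Integrable fun z => R0 α ω z ^ 2 * (A + B * R0 α ω z ^ 2 + C * (R0 α ω z ^ 2) ^ 2) := by
  have h2 := (integrable_R0_pow hω hβ 0).const_mul A
  have h4 := (integrable_R0_pow hω hβ 2).const_mul B
  have h6 := (integrable_R0_pow hω hβ 4).const_mul C
  refine ((h2.add h4).add h6).congr (Eventually.of_forall fun z => ?_)
  simp only [Pi.add_apply]
  ring

/-- The energy relation, integrated over the line. -/
theorem Lam2'_eq (hω : 0 < ω) (hβ : beta α ω < 1) :
    Lam2' α ω = ω * Lam 2 α ω - 1 / 2 * Lam 4 α ω - α / 3 * Lam 6 α ω := by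
  have e : (fun z => deriv (R0 α ω) z ^ 2) = fun z =>
      R0 α ω z ^ 2 * (ω + (-(1 / 2)) * R0 α ω z ^ 2 + (-(α / 3)) * (R0 α ω z ^ 2) ^ 2) := by
    funext z
    rw [(hasDerivAt_R0 hω z).deriv, mul_pow, S0_sq hω hβ]
    ring
  rw [Lam2', e, integral_quadratic_R0 hω hβ]
  ring

/-- The integral over the line of `(R₀² S₀)' = 2ωR₀² - (3/2)R₀⁴ - (4/3)αR₀⁶` vanishes. -/
theorem moment_relation (hω : 0 < ω) (hβ : beta α ω < 1) :
    2 * ω * Lam 2 α ω - 3 / 2 * Lam 4 α ω - 4 / 3 * α * Lam 6 α ω = 0 := by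
  have hd : ∀ z, HasDerivAt (fun z => R0 α ω z ^ 2 * S0 α ω z)
      (R0 α ω z ^ 2 * (2 * ω + (-(3 / 2)) * R0 α ω z ^ 2 +
        (-(4 / 3 * α)) * (R0 α ω z ^ 2) ^ 2)) z := by
    intro z
    refine (((hasDerivAt_R0 hω z).pow 2).mul (hasDerivAt_S0 hω hβ z)).congr_deriv ?_
    simp only [Nat.cast_ofNat, Nat.add_one_sub_one, pow_one, Pi.pow_apply]
    linear_combination (2 * R0 α ω z ^ 2) * S0_sq hω hβ z
  have hlim : ∀ (l : Filter ℝ) (c : ℝ), l ≤ cocompact ℝ → Tendsto (S0 α ω) l (𝓝 c) →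
      Tendsto (fun z => R0 α ω z ^ 2 * S0 α ω z) l (𝓝 0) := by
    intro l c hl hc
    have := (((tendsto_R0 hω hβ).mono_left hl).pow 2).mul hc
    simpa using this
  have := integral_of_hasDerivAt_of_tendsto hd
    (integrable_quadratic_R0 hω hβ _ _ _)
    (hlim _ _ atBot_le_cocompact (tendsto_S0_atBot hω hβ))
    (hlim _ _ atTop_le_cocompact (tendsto_S0_atTop hω hβ))
  rw [integral_quadratic_R0 hω hβ] at this
  linarith

theorem LamD2_eq (hω : 0 < ω) (hβ : beta α ω < 1) :
    LamD2 α ω = Lam 6 α ω / Lam 4 α ω := by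
  unfold LamD2
  split_ifs with h
  · rfl
  · have h4 := (Lam_four_pos hω hβ).ne'
    have hα : α ≠ 0 := by
      rintro rfl
      exact h (by simp [beta])
    have hm := moment_relation hω hβ
    rw [Lam24, beta]
    field_simp
    linear_combination 48 * hm

/-- `d₁*` is the root of the solvability condition, which is affine in `d₁`. -/
theorem solvability_eq (hω : 0 < ω) (hβ : beta α ω < 1) (a b d₁ d₂ : ℝ) :
    Lam2' α ω * a - Lam 2 α ω * b - Lam 4 α ω * d₁ - Lam 6 α ω * d₂ =
      Lam 4 α ω * (d1Star α ω a b d₂ - d₁) := by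
  have h4 := (Lam_four_pos hω hβ).ne'
  have hm := moment_relation hω hβ
  rw [d1Star, LamD2_eq hω hβ, Lam24, Lam2'_eq hω hβ]
  field_simp
  linear_combination 12 * a * hm

theorem solvability_iff (hω : 0 < ω) (hβ : beta α ω < 1) (a b d₁ d₂ : ℝ) :
    Lam2' α ω * a - Lam 2 α ω * b - Lam 4 α ω * d₁ - Lam 6 α ω * d₂ = 0 ↔
      d₁ = d1Star α ω a b d₂ := by
  rw [solvability_eq hω hβ, mul_eq_zero, or_iff_right (Lam_four_pos hω hβ).ne', sub_eq_zero,
    eq_comm]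

/-- The solvability condition as the vanishing of the integral of the `O(ε)` forcing in the
equation for `r²φ`, evaluated on the unperturbed wave. -/
theorem integral_forcing_eq_zero (hω : 0 < ω) (hβ : beta α ω < 1) (a b d₂ : ℝ) :
    ∫ z, R0 α ω z ^ 2 * ((b + a * ω) + (d1Star α ω a b d₂ - a) * R0 α ω z ^ 2 +
      (d₂ - a * α) * (R0 α ω z ^ 2) ^ 2) = 0 := by
  rw [integral_quadratic_R0 hω hβ]
  have h := (solvability_iff hω hβ a b _ d₂).2 rfl
  rw [Lam2'_eq hω hβ] at h
  linear_combination (-1) * h + a * moment_relation hω hβ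

end Moments

/-! ### Orbits near the unperturbed wave -/

/-- Quantitative bounds shared by all orbits near the unperturbed wave: `K` is the constant of
outward decay, `m` a lower bound of the amplitude on `[0, 1]`, `κ` a lower bound of the factor
`½ + ⅔ α r²`, and `s` has the sign of `-z` for `|z| ≥ Z`. -/
structure ControlledOrbit (α ω K m κ Z : ℝ) (r s φ : ℝ → ℝ) : Prop where
  hasDerivAt_r : ∀ z, HasDerivAt r (r z * s z) z
  pos : ∀ z, 0 < r z
  decay : ∀ z t, Outward z t → r t ^ 2 * (1 + (t - z) ^ 2) ≤ K * r z ^ 2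
  r_le : ∀ z, r z ≤ 3 * Real.sqrt ω
  abs_s_le : ∀ z, |s z| ≤ 2 * Real.sqrt ω
  abs_phi_le : ∀ z, |φ z| ≤ 1
  le_r : ∀ z ∈ Set.Icc (0 : ℝ) 1, m ≤ r z
  le_factor : ∀ z, κ ≤ 1 / 2 + 2 * α / 3 * r z ^ 2
  s_nonpos : ∀ z, Z ≤ z → s z ≤ 0
  s_nonneg : ∀ z, z ≤ -Z → 0 ≤ s z

theorem exists_controlledOrbit {α ω : ℝ} (hω : 0 < ω) (hβ : beta α ω < 1) :
    ∃ K > 0, ∃ m > 0, ∃ κ > 0, ∃ Z : ℝ, ∃ δ > 0, ∀ r s φ : ℝ → ℝ,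
      (∀ z, HasDerivAt r (r z * s z) z) → (∀ z, 0 < r z) →
      (∀ z, |r z - R0 α ω z| ≤ δ ∧ |s z - S0 α ω z| ≤ δ ∧ |φ z| ≤ δ) →
      ControlledOrbit α ω K m κ Z r s φ := by
  have hμ : 0 < Real.sqrt ω := Real.sqrt_pos.2 hω
  obtain ⟨K, hK, hdecay⟩ := exists_outward_decay hω hβ
  obtain ⟨x, -, hx⟩ := isCompact_Icc.exists_isMinOn (Set.nonempty_Icc.2 (zero_le_one' ℝ))
    (continuous_R0 (α := α) hω).continuousOn
  have hm := R0_pos (α := α) hω x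
  have hκ : 0 < min 1 (Real.sqrt (1 - beta α ω)) / 2 :=
    half_pos (lt_min one_pos (sqrt_one_sub_beta_pos hβ))
  set κ := min 1 (Real.sqrt (1 - beta α ω)) / 2 with hκdef
  obtain ⟨Z, hZ⟩ := eventually_atTop.1 ((tendsto_S0_atTop hω hβ).eventually_le_const
    (show -Real.sqrt ω < -(Real.sqrt ω / 2) by linarith))
  -- the last bound on `δ` keeps `⅔ |α| |r² - R₀²| ≤ ⅔ |α| · 5√ω δ` below `κ / 2`
  refine ⟨K, hK, R0 α ω x / 2, half_pos hm, κ / 2, half_pos hκ, Z,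
    min (min (Real.sqrt ω / 2) 1) (min (R0 α ω x / 2)
      (κ / 2 / (4 * |α| * Real.sqrt ω + 1))), by positivity, fun r s φ hr hpos hnear => ?_⟩
  set δ := min (min (Real.sqrt ω / 2) 1) (min (R0 α ω x / 2)
      (κ / 2 / (4 * |α| * Real.sqrt ω + 1))) with hδ
  have hδ1 : δ ≤ Real.sqrt ω / 2 := (min_le_left _ _).trans (min_le_left _ _)
  have hδ2 : δ ≤ 1 := (min_le_left _ _).trans (min_le_right _ _)
  have hδ3 : δ ≤ R0 α ω x / 2 := (min_le_right _ _).trans (min_le_left _ _)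
  have hδ4 : δ * (4 * |α| * Real.sqrt ω + 1) ≤ κ / 2 :=
    (le_div_iff₀ (by positivity)).1 ((min_le_right _ _).trans (min_le_right _ _))
  have hrle : ∀ z, r z ≤ 3 * Real.sqrt ω := fun z => by
    linarith [(abs_le.1 (hnear z).1).2, R0_le (α := α) hω z]
  refine ⟨hr, hpos, hdecay r s hr hpos fun z => (hnear z).2.1.trans hδ1, hrle, fun z => ?_,
    fun z => (hnear z).2.2.trans hδ2, fun z hz => ?_, fun z => ?_, fun z hz => ?_,
    fun z hz => ?_⟩
  · have h1 := abs_le.1 (hnear z).2.1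
    have h2 := abs_le.1 (abs_S0_le hω hβ z)
    rw [abs_le]
    constructor <;> linarith
  · have h1 : R0 α ω x ≤ R0 α ω z := hx hz
    linarith [(abs_le.1 (hnear z).1).1]
  · have h0 := half_min_le_factor hω hβ z
    have hδ0 : 0 ≤ δ := (abs_nonneg _).trans (hnear z).1
    have h1 : |2 * α / 3 * (r z ^ 2 - R0 α ω z ^ 2)| ≤ κ / 2 := by
      have e : 2 * α / 3 * (r z ^ 2 - R0 α ω z ^ 2) =
        2 / 3 * α * ((r z - R0 α ω z) * (r z + R0 α ω z)) := by ring
      rw [e, abs_mul, abs_mul, abs_mul, abs_of_pos (by norm_num : (0 : ℝ) < 2 / 3),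
        abs_of_pos (add_pos (hpos z) (R0_pos hω z))]
      have h5 : r z + R0 α ω z ≤ 5 * Real.sqrt ω := by linarith [hrle z, R0_le (α := α) hω z]
      have h6 : 0 ≤ |α| * (δ * Real.sqrt ω) := by positivity
      calc 2 / 3 * |α| * (|r z - R0 α ω z| * (r z + R0 α ω z))
          ≤ 2 / 3 * |α| * (δ * (5 * Real.sqrt ω)) := by
            have := (add_pos (hpos z) (R0_pos (α := α) hω z)).le
            have := (hnear z).1
            gcongr
        _ ≤ δ * (4 * |α| * Real.sqrt ω + 1) := by nlinarith
        _ ≤ κ / 2 := hδ4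
    linarith [(abs_le.1 h1).1]
  · linarith [(abs_le.1 (hnear z).2.1).2, hZ z hz]
  · have h1 := hZ (-z) (by linarith)
    rw [S0_neg hω] at h1
    linarith [(abs_le.1 (hnear z).2.1).1]

section ControlledOrbit

variable {α ω K m κ Z : ℝ} {r s φ : ℝ → ℝ}

theorem ControlledOrbit.continuous_r (O : ControlledOrbit α ω K m κ Z r s φ) : Continuous r :=
  continuous_iff_continuousAt.2 fun z => (O.hasDerivAt_r z).continuousAt

theorem ControlledOrbit.sq_le (O : ControlledOrbit α ω K m κ Z r s φ) (hω : 0 < ω) (z : ℝ) :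
    r z ^ 2 ≤ 9 * ω := by
  have := pow_le_pow_left₀ (O.pos z).le (O.r_le z) 2
  rw [mul_pow, Real.sq_sqrt hω.le] at this
  linarith

theorem ControlledOrbit.K_nonneg (O : ControlledOrbit α ω K m κ Z r s φ) : 0 ≤ K := by
  have h := O.decay 0 0 (outward_zero 0)
  have h2 : 0 < r 0 ^ 2 := pow_pos (O.pos 0) 2
  by_contra! hK
  nlinarith

theorem ControlledOrbit.sq_mul_le (O : ControlledOrbit α ω K m κ Z r s φ) (hω : 0 < ω) (z : ℝ) :
    r z ^ 2 * (1 + z ^ 2) ≤ 9 * K * ω := by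
  have h := O.decay 0 z (outward_zero z)
  rw [sub_zero] at h
  nlinarith [mul_le_mul_of_nonneg_left (O.sq_le hω 0) O.K_nonneg]

theorem ControlledOrbit.tendsto_r (O : ControlledOrbit α ω K m κ Z r s φ) (hω : 0 < ω) :
    Tendsto r (cocompact ℝ) (𝓝 0) :=
  tendsto_zero_of_sq_mul_le (O.sq_mul_le hω)

theorem ControlledOrbit.tendsto_sq_mul (O : ControlledOrbit α ω K m κ Z r s φ) (hω : 0 < ω)
    {f : ℝ → ℝ} {F : ℝ} (hF : ∀ z, |f z| ≤ F) :
    Tendsto (fun z => r z ^ 2 * f z) (cocompact ℝ) (𝓝 0) := by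
  have h := (O.tendsto_r hω).pow 2
  rw [zero_pow two_ne_zero] at h
  exact h.zero_mul_isBoundedUnder_le (isBoundedUnder_of ⟨F, hF⟩)

/-- If `f` is bounded and `(r² f)' = r² g`, then `r² f` is the integral of `r² g` from the
nearer end of the line. By outward decay this integral is at most a multiple of `r² sup |g|`;
it is compared with an arctangent. -/
theorem ControlledOrbit.abs_le_of_hasDerivAt_sq_mul (O : ControlledOrbit α ω K m κ Z r s φ)
    (hω : 0 < ω) {f g : ℝ → ℝ} {F G : ℝ}
    (hf : ∀ z, HasDerivAt (fun z => r z ^ 2 * f z) (r z ^ 2 * g z) z)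
    (hF : ∀ z, |f z| ≤ F) (hG : ∀ z, |g z| ≤ G) (z : ℝ) :
    |f z| ≤ G * (K * (Real.pi / 2)) := by
  have hG0 : 0 ≤ G := (abs_nonneg _).trans (hG 0)
  have hK := O.K_nonneg
  have hr2 : 0 < r z ^ 2 := pow_pos (O.pos z) 2
  have hlim := O.tendsto_sq_mul hω hF
  have hcmp : ∀ t, HasDerivAt (fun t => G * (K * r z ^ 2) * Real.arctan (t - z))
      (G * (K * r z ^ 2) * (1 / (1 + (t - z) ^ 2))) t := fun t => by
    have := ((hasDerivAt_id t).sub_const z).arctan.const_mul (G * (K * r z ^ 2))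
    simpa using this
  have hder : ∀ t, Outward z t →
      |r t ^ 2 * g t| ≤ G * (K * r z ^ 2) * (1 / (1 + (t - z) ^ 2)) := by
    intro t ht
    rw [abs_mul, abs_of_nonneg (sq_nonneg _), mul_one_div, le_div_iff₀ (by positivity)]
    calc r t ^ 2 * |g t| * (1 + (t - z) ^ 2) ≤ r t ^ 2 * G * (1 + (t - z) ^ 2) := by
          have := hG t
          gcongr
      _ = G * (r t ^ 2 * (1 + (t - z) ^ 2)) := by ring
      _ ≤ _ := mul_le_mul_of_nonneg_left (O.decay z t ht) hG0
  have hfar : ∀ l : Filter ℝ, l ≤ cocompact ℝ → l.NeBot →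
      (∀ᶠ T in l, |r T ^ 2 * f T - r z ^ 2 * f z| ≤ G * (K * r z ^ 2) * (Real.pi / 2)) →
      |f z| ≤ G * (K * (Real.pi / 2)) := by
    intro l hl hne hev
    have h1 := ((hlim.mono_left hl).sub_const (r z ^ 2 * f z)).abs
    have h2 := le_of_tendsto h1 hev
    rw [zero_sub, abs_neg, abs_mul, abs_of_pos hr2] at h2
    refine le_of_mul_le_mul_left (h2.trans_eq ?_) hr2
    ring
  rcases le_total 0 z with hz | hz
  · refine hfar atTop atTop_le_cocompact inferInstance ?_
    filter_upwards [eventually_ge_atTop z] with T hT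
    refine (abs_sub_le_of_abs_deriv_le hT hf hcmp
      fun t ht => hder t (Or.inl ⟨hz, ht.1⟩)).trans ?_
    rw [sub_self, Real.arctan_zero, mul_zero, sub_zero]
    have := (Real.arctan_lt_pi_div_two (T - z)).le
    gcongr
  · refine hfar atBot atBot_le_cocompact inferInstance ?_
    filter_upwards [eventually_le_atBot z] with T hT
    rw [abs_sub_comm]
    refine (abs_sub_le_of_abs_deriv_le hT hf hcmp
      fun t ht => hder t (Or.inr ⟨ht.2, hz⟩)).trans ?_
    rw [sub_self, Real.arctan_zero, mul_zero, zero_sub, ← mul_neg]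
    have : -Real.arctan (T - z) ≤ Real.pi / 2 := by
      linarith [Real.neg_pi_div_two_lt_arctan (T - z)]
    gcongr

theorem ControlledOrbit.exists_primitive (O : ControlledOrbit α ω K m κ Z r s φ) (hm : 0 < m) :
    ∃ L : ℝ → ℝ, (∀ z, HasDerivAt L (r z ^ 4) z) ∧ ∀ T, 1 ≤ T → m ^ 4 ≤ L T - L (-T) := by
  have hd : ∀ z, HasDerivAt (fun z => ∫ t in (0 : ℝ)..z, r t ^ 4) (r z ^ 4) z := fun z =>
    ((O.continuous_r.pow 4).integral_hasStrictDerivAt 0 z).hasDerivAt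
  refine ⟨_, hd, fun T hT => ?_⟩
  set L : ℝ → ℝ := fun z => ∫ t in (0 : ℝ)..z, r t ^ 4
  have hmono : Monotone L := monotone_of_deriv_nonneg (fun z => (hd z).differentiableAt)
    fun z => by rw [(hd z).deriv]; positivity
  have h1 : m ^ 4 ≤ L 1 - L 0 := by
    have h := monotoneOn_of_deriv_nonneg (f := fun z => L z - m ^ 4 * z) (convex_Icc (0 : ℝ) 1)
      (fun t _ => ((hd t).sub ((hasDerivAt_id t).const_mul
        (m ^ 4))).continuousAt.continuousWithinAt)
      (fun t _ => ((hd t).sub ((hasDerivAt_id t).const_mul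
        (m ^ 4))).differentiableAt.differentiableWithinAt)
      (fun t ht => by
        have := ((hd t).sub ((hasDerivAt_id t).const_mul (m ^ 4))).deriv
        simp only [id] at this
        change 0 ≤ deriv (L - fun y => m ^ 4 * y) t
        rw [this, mul_one, sub_nonneg]
        exact pow_le_pow_left₀ hm.le (O.le_r t (interior_subset ht)) 4)
      (Set.left_mem_Icc.2 zero_le_one) (Set.right_mem_Icc.2 zero_le_one) zero_le_one
    simp only [mul_zero, mul_one, sub_zero] at h
    linarith
  linarith [hmono hT, hmono (show -T ≤ 0 by linarith)]

/-- If the polynomial forcing `r² (A + B r² + C r⁴)` is the derivative of a function vanishing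
at both ends, its integral is zero, which bounds `B` in terms of `A` and `C`. -/
theorem ControlledOrbit.abs_coeff_le (O : ControlledOrbit α ω K m κ Z r s φ) (hω : 0 < ω)
    (hm : 0 < m) {A B C : ℝ} {J : ℝ → ℝ}
    (hJ : ∀ z, HasDerivAt J (r z ^ 2 * (A + B * r z ^ 2 + C * (r z ^ 2) ^ 2)) z)
    (hlim : Tendsto J (cocompact ℝ) (𝓝 0)) :
    |B| ≤ (|A| + |C| * (9 * ω) ^ 2) * (9 * K * ω) * Real.pi / m ^ 4 := by
  obtain ⟨L, hL, hLm⟩ := O.exists_primitive hm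
  set Q := (|A| + |C| * (9 * ω) ^ 2) * (9 * K * ω) with hQ
  have hQ0 : 0 ≤ Q := by
    have := O.K_nonneg
    positivity
  have hcmp : ∀ t, HasDerivAt (fun t => Q * Real.arctan t) (Q * (1 / (1 + t ^ 2))) t :=
    fun t => (Real.hasDerivAt_arctan t).const_mul Q
  have hder : ∀ t, |r t ^ 2 * (A + B * r t ^ 2 + C * (r t ^ 2) ^ 2) - B * r t ^ 4| ≤
      Q * (1 / (1 + t ^ 2)) := by
    intro t
    have e : r t ^ 2 * (A + B * r t ^ 2 + C * (r t ^ 2) ^ 2) - B * r t ^ 4 =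
      r t ^ 2 * (A + C * (r t ^ 2) ^ 2) := by ring
    have h1 : |A + C * (r t ^ 2) ^ 2| ≤ |A| + |C| * (9 * ω) ^ 2 := by
      refine (abs_add_le _ _).trans ?_
      rw [abs_mul, abs_of_nonneg (sq_nonneg (r t ^ 2))]
      have := O.sq_le hω t
      gcongr
    rw [e, abs_mul, abs_of_nonneg (sq_nonneg _), mul_one_div, le_div_iff₀ (by positivity)]
    calc _ = |A + C * (r t ^ 2) ^ 2| * (r t ^ 2 * (1 + t ^ 2)) := by ring
      _ ≤ Q := mul_le_mul h1 (O.sq_mul_le hω t) (by positivity) (by positivity)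
  have hev : ∀ T, 1 ≤ T → |B| * m ^ 4 ≤ Q * Real.pi + (|J T| + |J (-T)|) := by
    intro T hT
    have h := abs_sub_le_of_abs_deriv_le (show -T ≤ T by linarith)
      (fun t => (hJ t).sub ((hL t).const_mul B)) hcmp (fun t _ => hder t)
    have harc : Q * Real.arctan T - Q * Real.arctan (-T) ≤ Q * Real.pi := by
      rw [← mul_sub]
      have := Real.arctan_lt_pi_div_two T
      have := Real.neg_pi_div_two_lt_arctan (-T)
      gcongr
      linarith
    simp only [Pi.sub_apply] at h
    have h2 : |B * (L T - L (-T))| ≤ Q * Real.pi + (|J T| + |J (-T)|) := by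
      have e : B * (L T - L (-T)) =
        -((J T - B * L T) - (J (-T) - B * L (-T))) + (J T - J (-T)) := by ring
      rw [e]
      refine (abs_add_le _ _).trans (add_le_add ?_ (abs_sub _ _))
      rw [abs_neg]
      exact h.trans harc
    have hLpos := hLm T hT
    rw [abs_mul, abs_of_nonneg (by linarith [pow_pos hm 4] : 0 ≤ L T - L (-T))] at h2
    exact (mul_le_mul_of_nonneg_left hLpos (abs_nonneg B)).trans h2
  rw [le_div_iff₀ (by positivity)]
  have h1 := (hlim.mono_left atTop_le_cocompact).abs
  have h2 := ((hlim.mono_left atBot_le_cocompact).comp tendsto_neg_atTop_atBot).abs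
  have h3 := (h1.add h2).const_add (Q * Real.pi)
  simp only [abs_zero, add_zero] at h3
  refine ge_of_tendsto h3 ?_
  filter_upwards [eventually_ge_atTop 1] with T hT
  exact hev T hT

end ControlledOrbit

/-! ### The homoclinic orbit as a curve in the phase plane -/

/-- On the homoclinic orbit, the factor `½ + ⅔ α r²` as a function of `s`. The truncation at
`κ²` makes it continuous and positive on the whole line. -/
noncomputable def phaseFactor (α ω κ s : ℝ) : ℝ :=
  Real.sqrt (max (κ ^ 2) (1 / 4 + 4 * α / 3 * (ω - s ^ 2)))

/-- On the homoclinic orbit, the squared amplitude `r²` as a function of `s`. -/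
noncomputable def phaseSq (α ω κ s : ℝ) : ℝ := 2 * (ω - s ^ 2) / (phaseFactor α ω κ s + 1 / 2)

/-- The density with respect to `-ds` of the form `r² (A + B r² + C r⁴) dz` along the homoclinic
orbit. -/
noncomputable def phaseForcing (α ω κ A B C s : ℝ) : ℝ :=
  (A + B * phaseSq α ω κ s + C * phaseSq α ω κ s ^ 2) / phaseFactor α ω κ s

theorem le_phaseFactor (α ω κ s : ℝ) : κ ≤ phaseFactor α ω κ s :=
  Real.le_sqrt_of_sq_le (le_max_left _ _)

theorem continuous_phaseFactor (α ω κ : ℝ) : Continuous (phaseFactor α ω κ) := by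
  unfold phaseFactor
  fun_prop

theorem continuous_phaseForcing {κ : ℝ} (hκ : 0 < κ) (α ω A B C : ℝ) :
    Continuous (phaseForcing α ω κ A B C) := by
  have hq := continuous_phaseFactor α ω κ
  have hpos := fun s => hκ.trans_le (le_phaseFactor α ω κ s)
  have hU : Continuous (phaseSq α ω κ) := by
    unfold phaseSq
    exact Continuous.div (by fun_prop) (by fun_prop)
      fun s => (add_pos (hpos s) one_half_pos).ne'
  unfold phaseForcing
  exact Continuous.div (by fun_prop) hq fun s => (hpos s).ne'

/-- Near the zero level of the energy, `phaseFactor` is close to `½ + ⅔ α r²`. -/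
theorem abs_phaseFactor_sub_le {α ω κ r s : ℝ} (hκ : 0 < κ)
    (hp : κ ≤ 1 / 2 + 2 * α / 3 * r ^ 2) :
    |phaseFactor α ω κ s - (1 / 2 + 2 * α / 3 * r ^ 2)| ≤
      2 * |α| / (3 * κ) * |s ^ 2 - ω + r ^ 2 / 2 + α / 3 * r ^ 4| := by
  have hq := le_phaseFactor α ω κ s
  set q := phaseFactor α ω κ s with hqdef
  set p := 1 / 2 + 2 * α / 3 * r ^ 2 with hpdef
  set e := s ^ 2 - ω + r ^ 2 / 2 + α / 3 * r ^ 4 with he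
  have hq2 : q ^ 2 = max (κ ^ 2) (1 / 4 + 4 * α / 3 * (ω - s ^ 2)) :=
    Real.sq_sqrt ((sq_nonneg κ).trans (le_max_left _ _))
  have hp2 : p ^ 2 = max (κ ^ 2) (p ^ 2) := (max_eq_right (pow_le_pow_left₀ hκ.le hp 2)).symm
  have h1 : |q ^ 2 - p ^ 2| ≤ 4 * |α| / 3 * |e| := by
    rw [hq2, hp2]
    refine (abs_max_sub_max_le_max _ _ _ _).trans ?_
    rw [sub_self, abs_zero, max_eq_right (abs_nonneg _)]
    have : 1 / 4 + 4 * α / 3 * (ω - s ^ 2) - p ^ 2 = -(4 / 3 * α * e) := by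
      rw [hpdef, he]; ring
    rw [this, abs_neg, abs_mul, abs_mul, abs_of_pos (by norm_num : (0 : ℝ) < 4 / 3)]
    exact le_of_eq (by ring)
  have h2 : |q ^ 2 - p ^ 2| = |q - p| * (q + p) := by
    rw [sq_sub_sq, mul_comm, abs_mul, abs_of_pos (by linarith : 0 < q + p)]
  rw [h2] at h1
  have h3 : |q - p| * (2 * κ) ≤ 4 * |α| / 3 * |e| :=
    (mul_le_mul_of_nonneg_left (by linarith) (abs_nonneg _)).trans h1
  rw [div_mul_eq_mul_div, le_div_iff₀ (by positivity)]
  linarith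

/-- On an orbit whose energy and whose residual in the unperturbed equation are at most `E`,
the form `r² (A + B r² + C r⁴) dz` agrees with `-phaseForcing ds` up to `O(E)`. -/
theorem exists_forcing_estimate {ω κ : ℝ} (hω : 0 < ω) (hκ : 0 < κ) (α A B C E₁ : ℝ) :
    ∃ M, 0 ≤ M ∧ ∀ r s s' E : ℝ, r ^ 2 ≤ 9 * ω → s ^ 2 ≤ 4 * ω →
      κ ≤ 1 / 2 + 2 * α / 3 * r ^ 2 → E ≤ E₁ →
      |s ^ 2 - ω + r ^ 2 / 2 + α / 3 * r ^ 4| ≤ E →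
      |s' + s ^ 2 - ω + r ^ 2 + α * r ^ 4| ≤ E →
      |r ^ 2 * (A + B * r ^ 2 + C * (r ^ 2) ^ 2) + phaseForcing α ω κ A B C s * s'| ≤ M * E := by
  -- with `q = phaseFactor`, `p = ½ + ⅔ α r²` and `U = phaseSq`, the constants bound
  -- `|q - p| / E`, `|r² + s'/q| / E`, `|r² - U| / E`, `|s'|`, the polynomial at `r²`, and its
  -- divided difference between `r²` and `U`, in this order
  set c₀ := 2 * |α| / (3 * κ) with hc₀
  set c₁ := (9 * ω * c₀ + 2) / κ with hc₁
  set c₂ := 2 * (2 + 9 * ω * c₀) with hc₂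
  set c₃ := 2 * |E₁| + 9 * ω * (1 / 2 + 2 * |α| / 3 * (9 * ω)) with hc₃
  set c₄ := |A| + |B| * (9 * ω) + |C| * (9 * ω) ^ 2 with hc₄
  set c₅ := |B| + |C| * (9 * ω + 20 * ω) with hc₅
  have hc₀0 : 0 ≤ c₀ := by positivity
  refine ⟨c₄ * c₁ + c₂ * c₅ * (c₃ / κ), by positivity, fun r s s' E hr hs hp hE he hη => ?_⟩
  have hE0 : 0 ≤ E := (abs_nonneg _).trans he
  have hq := le_phaseFactor α ω κ s
  have hqp := (abs_phaseFactor_sub_le (ω := ω) (s := s) hκ hp).trans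
    (mul_le_mul_of_nonneg_left he hc₀0)
  rw [phaseForcing]
  have hUdef : phaseSq α ω κ s = 2 * (ω - s ^ 2) / (phaseFactor α ω κ s + 1 / 2) := rfl
  set q := phaseFactor α ω κ s with hqdef
  set U := phaseSq α ω κ s with hU
  set p := 1 / 2 + 2 * α / 3 * r ^ 2 with hpdef
  set e := s ^ 2 - ω + r ^ 2 / 2 + α / 3 * r ^ 4 with hedef
  set η := s' + s ^ 2 - ω + r ^ 2 + α * r ^ 4 with hηdef
  have hq0 : 0 < q := hκ.trans_le hq
  have hr0 := sq_nonneg r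
  have hs' : s' = -e - r ^ 2 * p + η := by rw [hedef, hηdef, hpdef]; ring
  have hrqp : |r ^ 2 * (q - p)| ≤ 9 * ω * (c₀ * E) := by
    rw [abs_mul, abs_of_nonneg hr0]
    exact mul_le_mul hr hqp (abs_nonneg _) (by positivity)
  have h1 : |r ^ 2 + s' / q| ≤ c₁ * E := by
    have e1 : r ^ 2 + s' / q = (r ^ 2 * (q - p) - e + η) / q := by
      rw [hs']; field_simp; ring
    have h2 : |r ^ 2 * (q - p) - e + η| ≤ 9 * ω * (c₀ * E) + E + E :=
      (abs_add_le _ _).trans (add_le_add ((abs_sub _ _).trans (add_le_add hrqp he)) hη)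
    rw [e1, abs_div, abs_of_pos hq0, hc₁, div_mul_eq_mul_div]
    exact div_le_div₀ (by positivity) (h2.trans_eq (by ring)) hκ hq
  have h2 : |r ^ 2 - U| ≤ c₂ * E := by
    have e1 : r ^ 2 - U = (2 * e + r ^ 2 * (q - p)) / (q + 1 / 2) := by
      rw [hUdef, hedef, hpdef]; field_simp; ring
    have h3 : |2 * e + r ^ 2 * (q - p)| ≤ 2 * E + 9 * ω * (c₀ * E) := by
      refine (abs_add_le _ _).trans (add_le_add ?_ hrqp)
      rw [abs_mul, abs_two]
      gcongr
    rw [e1, abs_div, abs_of_pos (by positivity : 0 < q + 1 / 2), div_le_iff₀ (by positivity)]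
    have h4 : c₂ * E = 2 * (2 * E + 9 * ω * (c₀ * E)) := by rw [hc₂]; ring
    have h5 : 0 ≤ 2 * E + 9 * ω * (c₀ * E) := by positivity
    have h6 := mul_nonneg h5 hq0.le
    rw [h4]
    linarith
  have h3 : |s'| ≤ c₃ := by
    have hp' : |p| ≤ 1 / 2 + 2 * |α| / 3 * (9 * ω) := by
      have e1 : |2 * α / 3 * r ^ 2| = 2 * |α| / 3 * r ^ 2 := by
        rw [abs_mul, abs_div, abs_mul, abs_two, abs_of_nonneg hr0,
          abs_of_pos (by norm_num : (0 : ℝ) < 3)]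
      refine (abs_add_le _ _).trans ?_
      rw [e1, abs_of_pos one_half_pos]
      gcongr
    have h4 : |r ^ 2 * p| ≤ 9 * ω * (1 / 2 + 2 * |α| / 3 * (9 * ω)) := by
      rw [abs_mul, abs_of_nonneg hr0]
      exact mul_le_mul hr hp' (abs_nonneg _) (by positivity)
    have hE' : E ≤ |E₁| := hE.trans (le_abs_self _)
    rw [hs']
    refine (abs_add_le _ _).trans ?_
    refine (add_le_add_left (abs_sub _ _) _).trans ?_
    rw [abs_neg]
    linarith
  have h4 : |A + B * r ^ 2 + C * (r ^ 2) ^ 2| ≤ c₄ := by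
    refine (abs_add_le _ _).trans (add_le_add ((abs_add_le _ _).trans
      (add_le_add le_rfl ?_)) ?_)
    · rw [abs_mul, abs_of_nonneg hr0]; gcongr
    · rw [abs_mul, abs_of_nonneg (sq_nonneg (r ^ 2))]; gcongr
  have hU20 : |U| ≤ 20 * ω := by
    rw [hUdef, abs_div, abs_of_pos (by positivity : 0 < q + 1 / 2), div_le_iff₀ (by positivity),
      abs_mul, abs_two]
    have : |ω - s ^ 2| ≤ 5 * ω := by
      rw [abs_le]
      constructor <;> linarith [sq_nonneg s]
    have := mul_pos hω hq0
    linarith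
  have h5 : |B + C * (r ^ 2 + U)| ≤ c₅ := by
    refine (abs_add_le _ _).trans (add_le_add le_rfl ?_)
    rw [abs_mul]
    refine mul_le_mul_of_nonneg_left ((abs_add_le _ _).trans (add_le_add ?_ hU20)) (abs_nonneg _)
    rwa [abs_of_nonneg hr0]
  have h6 : |s' / q| ≤ c₃ / κ := by
    rw [abs_div, abs_of_pos hq0]
    exact div_le_div₀ (by positivity) h3 hκ hq
  have e1 : r ^ 2 * (A + B * r ^ 2 + C * (r ^ 2) ^ 2) + (A + B * U + C * U ^ 2) / q * s' =
      (A + B * r ^ 2 + C * (r ^ 2) ^ 2) * (r ^ 2 + s' / q) -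
        (r ^ 2 - U) * (B + C * (r ^ 2 + U)) * (s' / q) := by
    field_simp
    ring
  rw [e1]
  refine (abs_sub _ _).trans ?_
  rw [abs_mul, abs_mul, abs_mul]
  calc _ ≤ c₄ * (c₁ * E) + c₂ * E * c₅ * (c₃ / κ) := by gcongr
    _ = _ := by ring

/-- If the forcing integrates to zero along the unperturbed wave, a primitive of `phaseForcing`
takes equal values at the two ends `±√ω` of the homoclinic orbit. -/
theorem phase_primitive_eq {α ω κ A B C : ℝ} (hω : 0 < ω) (hβ : beta α ω < 1) (hκ : 0 < κ)
    (hκ0 : ∀ z, κ ≤ 1 / 2 + 2 * α / 3 * R0 α ω z ^ 2)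
    (h0 : ∫ z, R0 α ω z ^ 2 * (A + B * R0 α ω z ^ 2 + C * (R0 α ω z ^ 2) ^ 2) = 0)
    {G : ℝ → ℝ} (hG : ∀ s, HasDerivAt G (phaseForcing α ω κ A B C s) s) :
    G (-Real.sqrt ω) = G (Real.sqrt ω) := by
  obtain ⟨M, -, hM⟩ := exists_forcing_estimate hω hκ α A B C 0
  have hd : ∀ z, HasDerivAt (fun z => -G (S0 α ω z))
      (R0 α ω z ^ 2 * (A + B * R0 α ω z ^ 2 + C * (R0 α ω z ^ 2) ^ 2)) z := by
    intro z
    refine ((hG (S0 α ω z)).comp z (hasDerivAt_S0 hω hβ z)).neg.congr_deriv ?_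
    have hsq := S0_sq hω hβ z
    have h := hM (R0 α ω z) (S0 α ω z) (-(R0 α ω z ^ 2) / 2 - 2 * α / 3 * R0 α ω z ^ 4) 0
      (by
        have := pow_le_pow_left₀ (R0_pos hω z).le (R0_le (α := α) hω z) 2
        rw [mul_pow, Real.sq_sqrt hω.le] at this
        linarith)
      (by
        have := pow_le_pow_left₀ (abs_nonneg _) (abs_S0_le hω hβ z) 2
        rw [sq_abs, Real.sq_sqrt hω.le] at this
        linarith) (hκ0 z) le_rfl
      (by rw [abs_nonpos_iff]; linarith) (by rw [abs_nonpos_iff]; linarith)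
    rw [mul_zero, abs_nonpos_iff] at h
    linarith
  have hGc : Continuous G := continuous_iff_continuousAt.2 fun s => (hG s).continuousAt
  have h := integral_of_hasDerivAt_of_tendsto hd (integrable_quadratic_R0 hω hβ _ _ _)
    ((hGc.tendsto _).comp (tendsto_S0_atBot hω hβ)).neg
    ((hGc.tendsto _).comp (tendsto_S0_atTop hω hβ)).neg
  rw [h0] at h
  linarith

/-! ### Standing waves of the perturbed system -/

section Steady

variable {α ω a b d₁ d₂ ε : ℝ} {r θ s φ : ℝ → ℝ}

theorem IsSteadyState.hasDerivAt_sq_mul_phi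
    (H : IsSteadyState ⟨α, ω, a, b, d₁, d₂⟩ ε 0 r θ s φ) (z : ℝ) :
    HasDerivAt (fun z => r z ^ 2 * φ z) (r z ^ 2 * (-(ε / (1 + ε ^ 2 * a ^ 2)) *
      ((b + a * ω) + (d₁ - a) * r z ^ 2 + (d₂ - a * α) * (r z ^ 2) ^ 2))) z := by
  have hΔ : 0 < 1 + ε ^ 2 * a ^ 2 := by positivity
  refine (((H.eq_r z).pow 2).mul (H.differentiable_phi z).hasDerivAt).congr_deriv ?_
  have h := H.eq_phi z
  simp only [Nat.cast_ofNat, Nat.add_one_sub_one, pow_one, Pi.pow_apply] at h ⊢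
  field_simp
  linear_combination r z ^ 2 * h

/-- In the equation for `s`, the perturbation enters through `φ²` and through the forcing of
the equation for `φ`, multiplied by `-ε² a / Δ`. -/
theorem IsSteadyState.residual_eq
    (H : IsSteadyState ⟨α, ω, a, b, d₁, d₂⟩ ε 0 r θ s φ) (z : ℝ) :
    deriv s z + s z ^ 2 - ω + r z ^ 2 + α * r z ^ 4 = φ z ^ 2 +
      -(ε ^ 2 / (1 + ε ^ 2 * a ^ 2)) * (a * ((b + a * ω) + (d₁ - a) * r z ^ 2 +
        (d₂ - a * α) * (r z ^ 2) ^ 2)) := by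
  have hΔ : 0 < 1 + ε ^ 2 * a ^ 2 := by positivity
  have h := H.eq_s z
  simp only at h
  field_simp
  linear_combination h

/-- `e = s² - ω + r²/2 + α r⁴/3` is the energy of the unperturbed system divided by `r²`. -/
theorem IsSteadyState.hasDerivAt_energy
    (H : IsSteadyState ⟨α, ω, a, b, d₁, d₂⟩ ε 0 r θ s φ) (z : ℝ) :
    HasDerivAt (fun z => r z ^ 2 * (s z ^ 2 - ω + r z ^ 2 / 2 + α / 3 * r z ^ 4))
      (r z ^ 2 * (2 * s z * (deriv s z + s z ^ 2 - ω + r z ^ 2 + α * r z ^ 4))) z := by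
  have hr := H.eq_r z
  have hs := (H.differentiable_s z).hasDerivAt
  refine ((hr.pow 2).mul ((((hs.pow 2).sub_const ω).add ((hr.pow 2).div_const 2)).add
    ((hr.pow 4).const_mul (α / 3)))).congr_deriv ?_
  simp only [Nat.cast_ofNat, Nat.add_one_sub_one, pow_one, Pi.pow_apply, Pi.add_apply]
  ring

end Steady

/-- Near the unperturbed wave, both the energy and the residual of the unperturbed equation
are `O(ε²)`, uniformly on the line and without any bound on `d₁` being assumed. -/
theorem exists_energy_estimate {α ω K m κ Z : ℝ} (hω : 0 < ω) (hK : 0 < K) (hm : 0 < m)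
    (a b d₂ : ℝ) :
    ∃ E₁, 0 ≤ E₁ ∧ ∀ (d₁ ε : ℝ) (r θ s φ : ℝ → ℝ), 0 < ε → ε ≤ 1 →
      IsSteadyState ⟨α, ω, a, b, d₁, d₂⟩ ε 0 r θ s φ → ControlledOrbit α ω K m κ Z r s φ →
      ∀ z, |s z ^ 2 - ω + r z ^ 2 / 2 + α / 3 * r z ^ 4| ≤ E₁ * ε ^ 2 ∧
        |deriv s z + s z ^ 2 - ω + r z ^ 2 + α * r z ^ 4| ≤ E₁ * ε ^ 2 := by
  have hπ := Real.pi_pos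
  -- in this order: bounds of `|d₁ - a|`, of the forcing, of `|φ| / ε`, of the residual over `ε²`
  -- and of the energy over `ε²`
  set c₁ := (|b + a * ω| + |d₂ - a * α| * (9 * ω) ^ 2) * (9 * K * ω) * Real.pi / m ^ 4 with hc₁
  set c₂ := |b + a * ω| + c₁ * (9 * ω) + |d₂ - a * α| * (9 * ω) ^ 2 with hc₂
  set c₃ := c₂ * (K * (Real.pi / 2)) with hc₃
  set c₄ := c₃ ^ 2 + |a| * c₂ with hc₄
  set c₅ := 2 * (2 * Real.sqrt ω) * c₄ * (K * (Real.pi / 2)) with hc₅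
  have hc₁0 : 0 ≤ c₁ := by positivity
  have hc₂0 : 0 ≤ c₂ := by positivity
  have hc₃0 : 0 ≤ c₃ := by positivity
  have hc₄0 : 0 ≤ c₄ := by positivity
  have hc₅0 : 0 ≤ c₅ := by positivity
  refine ⟨max c₄ c₅, le_max_of_le_left hc₄0, fun d₁ ε r θ s φ hε hε1 H O => ?_⟩
  set Δ := 1 + ε ^ 2 * a ^ 2 with hΔ
  have hΔ1 : 1 ≤ Δ := by
    have : 0 ≤ ε ^ 2 * a ^ 2 := by positivity
    linarith
  have hΔ0 : 0 < Δ := by linarith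
  set P : ℝ → ℝ := fun z => (b + a * ω) + (d₁ - a) * r z ^ 2 + (d₂ - a * α) * (r z ^ 2) ^ 2
    with hP
  have hφd : ∀ z, HasDerivAt (fun z => r z ^ 2 * φ z) (r z ^ 2 * (-(ε / Δ) * P z)) z :=
    H.hasDerivAt_sq_mul_phi
  -- `-(Δ/ε) r²φ` is a primitive of the forcing
  have hd₁ : |d₁ - a| ≤ c₁ := by
    refine O.abs_coeff_le hω hm (J := fun z => -(Δ / ε) * (r z ^ 2 * φ z)) (fun z => ?_) ?_
    · refine ((hφd z).const_mul (-(Δ / ε))).congr_deriv ?_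
      have h1 : -(Δ / ε) * -(ε / Δ) = 1 := by field_simp
      change _ = r z ^ 2 * P z
      linear_combination (r z ^ 2 * P z) * h1
    · have := (O.tendsto_sq_mul hω O.abs_phi_le).const_mul (-(Δ / ε))
      simpa using this
  have hPle : ∀ z, |P z| ≤ c₂ := fun z => by
    have h2 := O.sq_le hω z
    refine (abs_add_le _ _).trans (add_le_add ((abs_add_le _ _).trans (add_le_add le_rfl ?_)) ?_)
    · rw [abs_mul, abs_of_nonneg (sq_nonneg (r z))]; gcongr
    · rw [abs_mul, abs_of_nonneg (sq_nonneg (r z ^ 2))]; gcongr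
  have hφle : ∀ z, |φ z| ≤ c₃ * ε := fun z => by
    have h := O.abs_le_of_hasDerivAt_sq_mul hω hφd O.abs_phi_le (G := ε * c₂) (fun z => by
      rw [abs_mul, abs_neg, abs_of_pos (by positivity : 0 < ε / Δ)]
      exact mul_le_mul (div_le_self hε.le hΔ1) (hPle z) (abs_nonneg _) hε.le) z
    exact h.trans_eq (by rw [hc₃]; ring)
  have hη : ∀ z, |deriv s z + s z ^ 2 - ω + r z ^ 2 + α * r z ^ 4| ≤ c₄ * ε ^ 2 := fun z => by
    rw [H.residual_eq z]
    refine (abs_add_le _ _).trans ?_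
    have h1 : |φ z ^ 2| ≤ (c₃ * ε) ^ 2 := by
      rw [abs_pow]
      exact pow_le_pow_left₀ (abs_nonneg _) (hφle z) 2
    have h2 : |-(ε ^ 2 / Δ) * (a * P z)| ≤ ε ^ 2 * (|a| * c₂) := by
      rw [abs_mul, abs_neg, abs_of_pos (by positivity : 0 < ε ^ 2 / Δ), abs_mul]
      exact mul_le_mul (div_le_self (by positivity) hΔ1)
        (mul_le_mul_of_nonneg_left (hPle z) (abs_nonneg _)) (by positivity) (by positivity)
    exact (add_le_add h1 h2).trans_eq (by rw [hc₄]; ring)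
  have he : ∀ z, |s z ^ 2 - ω + r z ^ 2 / 2 + α / 3 * r z ^ 4| ≤ c₅ * ε ^ 2 := fun z => by
    have h := O.abs_le_of_hasDerivAt_sq_mul hω H.hasDerivAt_energy
      (F := (2 * Real.sqrt ω) ^ 2 + ω + 9 * ω / 2 + |α| / 3 * (9 * ω) ^ 2)
      (G := 2 * (2 * Real.sqrt ω) * (c₄ * ε ^ 2)) (fun z => by
        have h1 : |s z ^ 2| ≤ (2 * Real.sqrt ω) ^ 2 := by
          rw [abs_pow]
          exact pow_le_pow_left₀ (abs_nonneg _) (O.abs_s_le z) 2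
        have h2 := O.sq_le hω z
        have h3 : |r z ^ 2 / 2| ≤ 9 * ω / 2 := by
          rw [abs_of_nonneg (by positivity)]
          linarith
        have h4 : |α / 3 * r z ^ 4| ≤ |α| / 3 * (9 * ω) ^ 2 := by
          have e : r z ^ 4 = (r z ^ 2) ^ 2 := by ring
          rw [e, abs_mul, abs_div, abs_of_pos (by norm_num : (0 : ℝ) < 3),
            abs_of_nonneg (sq_nonneg (r z ^ 2))]
          gcongr
        refine (abs_add_le _ _).trans (add_le_add ((abs_add_le _ _).trans (add_le_add ?_ h3)) h4)
        refine (abs_sub _ _).trans (add_le_add h1 ?_)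
        rw [abs_of_pos hω]) (fun z => by
        rw [abs_mul, abs_mul, abs_two]
        have h1 := O.abs_s_le z
        have h2 := hη z
        gcongr) z
    exact h.trans_eq (by rw [hc₅]; ring)
  exact fun z => ⟨(he z).trans (mul_le_mul_of_nonneg_right (le_max_right _ _) (sq_nonneg ε)),
    (hη z).trans (mul_le_mul_of_nonneg_right (le_max_left _ _) (sq_nonneg ε))⟩

theorem abs_sub_le_of_sq_near {x μ c : ℝ} (hμ : 0 < μ) (hx : 0 ≤ x) (h : |x ^ 2 - μ ^ 2| ≤ c) :
    |x - μ| ≤ c / μ := by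
  rw [le_div_iff₀ hμ]
  refine le_trans ?_ h
  rw [sq_sub_sq, abs_mul, mul_comm, abs_of_pos (by linarith : 0 < x + μ)]
  exact mul_le_mul_of_nonneg_right (by linarith) (abs_nonneg _)

/-- The quantitative solvability condition. The function `G ∘ s - (Δ/ε) r²φ`, with `G` a
primitive of `phaseForcing`, has derivative `(d₁ - d₁*) r⁴ + O(ε²)`. Over `[-1/ε, 1/ε]` the
error accumulates to `O(ε)`, and the increment of the function is `O(ε)` because `r` is
`O(ε)` at the end points, so that `s` is close to `∓√ω` there. -/
theorem exists_abs_sub_d1Star_le {α ω : ℝ} (hω : 0 < ω) (hβ : beta α ω < 1) (a b d₂ : ℝ) :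
    ∃ δ > 0, ∃ ε₀ > 0, ∃ C : ℝ, ∀ ε d₁ : ℝ, 0 < ε → ε < ε₀ →
      HasBrightWaveNear ⟨α, ω, a, b, d₁, d₂⟩ ε δ → |d₁ - d1Star α ω a b d₂| ≤ C * ε := by
  have hμ : 0 < Real.sqrt ω := Real.sqrt_pos.2 hω
  obtain ⟨K, hK, m, hm, κ, hκ, Z, δ, hδ, hO⟩ := exists_controlledOrbit hω hβ
  have hO₀ := hO (R0 α ω) (S0 α ω) (fun _ => 0) (hasDerivAt_R0 hω) (R0_pos hω)
    (fun z => by simp [hδ.le])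
  obtain ⟨E₁, hE₁, hE⟩ := exists_energy_estimate (α := α) (κ := κ) (Z := Z) hω hK hm a b d₂
  set D := d1Star α ω a b d₂ with hD
  obtain ⟨M, hM0, hM⟩ :=
    exists_forcing_estimate hω hκ α (b + a * ω) (D - a) (d₂ - a * α) E₁
  set g := phaseForcing α ω κ (b + a * ω) (D - a) (d₂ - a * α) with hg
  have hgc : Continuous g := continuous_phaseForcing hκ α ω _ _ _
  obtain ⟨G, hG⟩ : ∃ G : ℝ → ℝ, ∀ x, HasDerivAt G (g x) x :=
    ⟨fun x => ∫ t in (0 : ℝ)..x, g t, fun x => (hgc.integral_hasStrictDerivAt 0 x).hasDerivAt⟩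
  have hGμ : G (-Real.sqrt ω) = G (Real.sqrt ω) :=
    phase_primitive_eq hω hβ hκ hO₀.le_factor (integral_forcing_eq_zero hω hβ a b d₂) hG
  obtain ⟨N, hN⟩ := (isCompact_Icc (a := -(2 * Real.sqrt ω))
    (b := 2 * Real.sqrt ω)).exists_bound_of_continuousOn hgc.continuousOn
  have hN0 : 0 ≤ N := (norm_nonneg _).trans (hN 0 ⟨by linarith, by linarith⟩)
  have hGlip : ∀ x y, |x| ≤ 2 * Real.sqrt ω → |y| ≤ 2 * Real.sqrt ω →
      |G x - G y| ≤ N * |x - y| := fun x y hx hy =>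
    Convex.norm_image_sub_le_of_norm_hasDerivWithin_le
      (fun t _ => (hG t).hasDerivWithinAt) hN (convex_Icc _ _) (abs_le.1 hy) (abs_le.1 hx)
  set c := E₁ + 9 * K * ω / 2 + |α| / 3 * (9 * ω * (9 * K * ω)) with hc
  refine ⟨δ, hδ, min 1 (1 / (|Z| + 1)), by positivity,
    (2 * M * E₁ + 2 * ((1 + a ^ 2) * (9 * K * ω)) + 2 * (N * (c / Real.sqrt ω))) / m ^ 4,
    fun ε d₁ hε hεlt hwave => ?_⟩
  obtain ⟨r, θ, s, φ, hb, hnear⟩ := hwave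
  have H := hb.steady
  have O := hO r s φ H.eq_r hb.pos hnear
  have hε1 : ε ≤ 1 := (hεlt.trans_le (min_le_left _ _)).le
  have hest := hE d₁ ε r θ s φ hε hε1 H O
  have hε2 : ε ^ 2 ≤ ε := by nlinarith
  set T := 1 / ε with hT
  have hT1 : 1 ≤ T := (one_le_div hε).2 hε1
  have hZT : Z ≤ T := by
    have h1 : ε * (|Z| + 1) ≤ 1 :=
      (le_div_iff₀ (by positivity)).1 (hεlt.trans_le (min_le_right _ _)).le
    rw [hT, le_div_iff₀ hε]
    nlinarith [le_abs_self Z, abs_nonneg Z]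
  set Δ := 1 + ε ^ 2 * a ^ 2 with hΔ
  have hΔ0 : 0 < Δ := by positivity
  have hΔ1 : Δ ≤ 1 + a ^ 2 := by nlinarith [sq_nonneg a]
  -- the amplitude at the end points
  have hrend : ∀ z, z ^ 2 = T ^ 2 → r z ^ 2 ≤ 9 * K * ω * ε ^ 2 := fun z hz => by
    have h1 := O.sq_mul_le hω z
    have h2 : z ^ 2 * ε ^ 2 = 1 := by rw [hz, hT]; field_simp
    have h3 := mul_le_mul_of_nonneg_right h1 (sq_nonneg ε)
    nlinarith [mul_nonneg (sq_nonneg (r z)) (sq_nonneg ε)]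
  have hsend : ∀ z, z ^ 2 = T ^ 2 → |s z ^ 2 - Real.sqrt ω ^ 2| ≤ c * ε ^ 2 := fun z hz => by
    have h1 := hrend z hz
    have h2 := (hest z).1
    have e : s z ^ 2 - Real.sqrt ω ^ 2 = (s z ^ 2 - ω + r z ^ 2 / 2 + α / 3 * r z ^ 4) +
        (-(r z ^ 2 / 2) + -(α / 3 * (r z ^ 2 * r z ^ 2))) := by
      rw [Real.sq_sqrt hω.le]; ring
    have h3 : |-(r z ^ 2 / 2)| ≤ 9 * K * ω * ε ^ 2 / 2 := by
      rw [abs_neg, abs_of_nonneg (by positivity)]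
      linarith
    have h4 : |-(α / 3 * (r z ^ 2 * r z ^ 2))| ≤ |α| / 3 * (9 * ω * (9 * K * ω * ε ^ 2)) := by
      rw [abs_neg, abs_mul, abs_div, abs_of_pos (by norm_num : (0 : ℝ) < 3),
        abs_of_nonneg (by positivity : 0 ≤ r z ^ 2 * r z ^ 2)]
      have := O.sq_le hω z
      gcongr
    rw [e]
    refine ((abs_add_le _ _).trans (add_le_add h2 ((abs_add_le _ _).trans
      (add_le_add h3 h4)))).trans_eq ?_
    rw [hc]; ring
  have hcε : c * ε ^ 2 / Real.sqrt ω ≤ c / Real.sqrt ω * ε := by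
    rw [mul_div_right_comm]
    gcongr
  have hGT : |G (s T) - G (-Real.sqrt ω)| ≤ N * (c / Real.sqrt ω * ε) := by
    refine (hGlip _ _ (O.abs_s_le T) (by rw [abs_neg, abs_of_pos hμ]; linarith)).trans ?_
    refine mul_le_mul_of_nonneg_left (le_trans ?_ hcε) hN0
    have h := abs_sub_le_of_sq_near hμ (neg_nonneg.2 (O.s_nonpos T hZT))
      ((neg_sq (s T)).symm ▸ hsend T rfl)
    have e : s T - -Real.sqrt ω = -(-s T - Real.sqrt ω) := by ring
    rw [e, abs_neg]
    exact h
  have hGT' : |G (s (-T)) - G (Real.sqrt ω)| ≤ N * (c / Real.sqrt ω * ε) := by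
    refine (hGlip _ _ (O.abs_s_le (-T)) (by rw [abs_of_pos hμ]; linarith)).trans ?_
    exact mul_le_mul_of_nonneg_left ((abs_sub_le_of_sq_near hμ
      (O.s_nonneg (-T) (neg_le_neg hZT)) (hsend (-T) (neg_sq T))).trans hcε) hN0
  have hJ : ∀ z, z ^ 2 = T ^ 2 → |Δ / ε * (r z ^ 2 * φ z)| ≤ (1 + a ^ 2) * (9 * K * ω) * ε :=
    fun z hz => by
      rw [abs_mul, abs_mul, abs_of_pos (by positivity : 0 < Δ / ε),
        abs_of_nonneg (sq_nonneg (r z))]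
      calc Δ / ε * (r z ^ 2 * |φ z|) ≤ (1 + a ^ 2) / ε * (9 * K * ω * ε ^ 2 * 1) := by
            have := hrend z hz
            have := O.abs_phi_le z
            gcongr
        _ = (1 + a ^ 2) * (9 * K * ω) * ε := by field_simp
  -- integration over `[-1/ε, 1/ε]`
  obtain ⟨L, hL, hLm⟩ := O.exists_primitive hm
  have hder : ∀ z, HasDerivAt
      (fun z => G (s z) - Δ / ε * (r z ^ 2 * φ z) - (d₁ - D) * L z)
      (r z ^ 2 * ((b + a * ω) + (D - a) * r z ^ 2 + (d₂ - a * α) * (r z ^ 2) ^ 2) +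
        g (s z) * deriv s z) z := fun z => by
    refine ((((hG (s z)).comp z (H.differentiable_s z).hasDerivAt).sub
      ((H.hasDerivAt_sq_mul_phi z).const_mul (Δ / ε))).sub
      ((hL z).const_mul (d₁ - D))).congr_deriv ?_
    simp only [← hΔ]
    field_simp
    ring
  have hlin : ∀ z, HasDerivAt (fun z => M * (E₁ * ε ^ 2) * z) (M * (E₁ * ε ^ 2)) z := fun z => by
    simpa using (hasDerivAt_id z).const_mul (M * (E₁ * ε ^ 2))
  have hmain := abs_sub_le_of_abs_deriv_le (show -T ≤ T by linarith) hder hlin (fun z _ => by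
    refine hM (r z) (s z) (deriv s z) (E₁ * ε ^ 2) (O.sq_le hω z) ?_ (O.le_factor z) ?_
      (hest z).1 (hest z).2
    · have := pow_le_pow_left₀ (abs_nonneg _) (O.abs_s_le z) 2
      rw [sq_abs, mul_pow, Real.sq_sqrt hω.le] at this
      linarith
    · nlinarith)
  have hlen : M * (E₁ * ε ^ 2) * T - M * (E₁ * ε ^ 2) * (-T) = 2 * M * E₁ * ε := by
    rw [hT]; field_simp; ring
  rw [hlen] at hmain
  have hJT := hJ T rfl
  have hJT' := hJ (-T) (neg_sq T)
  rw [← hGμ] at hGT'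
  have hfin : |(d₁ - D) * (L T - L (-T))| ≤
      (2 * M * E₁ + 2 * ((1 + a ^ 2) * (9 * K * ω)) + 2 * (N * (c / Real.sqrt ω))) * ε := by
    rw [abs_le] at hmain hGT hGT' hJT hJT' ⊢
    constructor <;> linarith [hmain.1, hmain.2, hGT.1, hGT.2, hGT'.1, hGT'.2, hJT.1, hJT.2,
      hJT'.1, hJT'.2]
  have hLT := hLm T hT1
  have hm4 : 0 < m ^ 4 := pow_pos hm 4
  rw [div_mul_eq_mul_div, le_div_iff₀ hm4]
  refine le_trans ?_ hfin
  rw [abs_mul, abs_of_pos (hm4.trans_le hLT)]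
  exact mul_le_mul_of_nonneg_left hLT (abs_nonneg _)

theorem HasBrightWaveNear.mono {p : Params} {ε δ δ' : ℝ} (h : HasBrightWaveNear p ε δ)
    (hδ : δ ≤ δ') : HasBrightWaveNear p ε δ' := by
  obtain ⟨r, θ, s, φ, hb, hn⟩ := h
  exact ⟨r, θ, s, φ, hb, fun z =>
    ⟨(hn z).1.trans hδ, (hn z).2.1.trans hδ, (hn z).2.2.trans hδ⟩⟩

end PCQNLS

theorem mainTheorem3 (α ω a b d₂ : ℝ) (hω : 0 < ω) (hβ : PCQNLS.beta α ω < 1) :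
    -- if bright waves persist along some `ε → 0⁺` with `d₁ → D`, the condition holds at `D`
    (∀ (D : ℝ) (ε d₁ δ : ℕ → ℝ), (∀ n, 0 < ε n) →
      Filter.Tendsto ε Filter.atTop (nhds 0) →
      Filter.Tendsto d₁ Filter.atTop (nhds D) →
      Filter.Tendsto δ Filter.atTop (nhds 0) →
      (∀ n, PCQNLS.HasBrightWaveNear
        { α := α, ω := ω, a := a, b := b, d₁ := d₁ n, d₂ := d₂ } (ε n) (δ n)) →
      PCQNLS.Lam2' α ω * a - PCQNLS.Lam 2 α ω * b - PCQNLS.Lam 4 α ω * D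
        - PCQNLS.Lam 6 α ω * d₂ = 0) ∧
    -- the condition is equivalent to `d₁ = d₁*`
    (∀ d₁ : ℝ,
      PCQNLS.Lam2' α ω * a - PCQNLS.Lam 2 α ω * b - PCQNLS.Lam 4 α ω * d₁
        - PCQNLS.Lam 6 α ω * d₂ = 0 ↔
      d₁ = PCQNLS.d1Star α ω a b d₂) ∧
    -- for small `ε > 0` a bright wave near the unperturbed one forces `d₁ = d₁* + O(ε)`
    (∃ δ > 0, ∃ ε₀ > 0, ∃ C : ℝ, ∀ ε d₁ : ℝ, 0 < ε → ε < ε₀ →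
      PCQNLS.HasBrightWaveNear
        { α := α, ω := ω, a := a, b := b, d₁ := d₁, d₂ := d₂ } ε δ →
      |d₁ - PCQNLS.d1Star α ω a b d₂| ≤ C * ε) := by
  have h3 := PCQNLS.exists_abs_sub_d1Star_le hω hβ a b d₂
  refine ⟨fun D ε d₁ δ hε hε0 hd hδ0 hw => ?_, fun d₁ => PCQNLS.solvability_iff hω hβ a b d₁ d₂,
    h3⟩
  obtain ⟨δ', hδ', ε₀, hε₀, C, hC⟩ := h3
  rw [PCQNLS.solvability_iff hω hβ]
  -- the quantitative bound forces `d₁ n → d₁*`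
  have hlim : Filter.Tendsto d₁ Filter.atTop (nhds (PCQNLS.d1Star α ω a b d₂)) := by
    rw [tendsto_iff_norm_sub_tendsto_zero]
    have hCε := hε0.const_mul C
    rw [mul_zero] at hCε
    refine squeeze_zero' (Filter.Eventually.of_forall fun n => norm_nonneg _) ?_ hCε
    filter_upwards [hε0.eventually_lt_const hε₀, hδ0.eventually_le_const hδ'] with n h1 h2
    exact hC (ε n) (d₁ n) (hε n) h1 ((hw n).mono h2)
  exact tendsto_nhds_unique hd hlim
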